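/- Let $k$ be a field. For a finite simple graph $G$ with vertex set $V$ let $R=k[x_v : v\in V]$, let $I(G)\subseteq R$ be the ideal generated by the products $x_ux_v$ over all edges $\{u,v\}$ of $G$, and regard $k$ as the $R$-module $R/\langle x_v : v\in V\rangle$. Put $$\beta_{i,d}(G)=\sum_{\mathbf a\in\mathbb N^V,\ |\mathbf a|=d}\dim_k \mathrm{Tor}_i^R(R/I(G),k)_{\mathbf a},\qquad \beta_i(G)=\dim_k\mathrm{Tor}_i^R(R/I(G),k),$$ and let $\mathrm{pd}(G)$ be the projective dimension of the $R$-module $R/I(G)$. For every field $k$ the following hold. (1) Let $n,m\ge 0$ be integers and let $K_{n,m}$ be the complete bipartite graph whose two classes have $n$ and $m$ vertices. Then $\beta_{0,0}(K_{n,m})=1$, and for all integers $i,d\ge 0$ with $(i,d)\ne(0,0)$ $$\beta_{i,d}(K_{n,m})=\begin{cases}\displaystyle\sum_{j+l=i+1,\ j,l\ge 1}\binom nj\binom ml & \text{if } d=i+1,\\ 0 & \text{if } d\neq i+1.\end{cases}$$ (2) Let $t\ge 0$ and $n_1,\dots,n_t\ge 0$ be integers and let $K_{n_1,\dots,n_t}$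 be the complete multipartite graph whose classes have $n_1,\dots,n_t$ vertices (two vertices are adjacent if and only if they lie in different classes). Then $\beta_{0,0}(K_{n_1,\dots,n_t})=1$, and for all integers $i,d\ge 0$ with $(i,d)\neq(0,0)$ $$\beta_{i,d}(K_{n_1,\dots,n_t})=\begin{cases}\displaystyle\sum_{l=2}^{t}(l-1)\sum_{j_1<\dots<j_l}\ \sum_{\substack{\alpha_1+\dots+\alpha_l=i+1\\ \alpha_1,\dots,\alpha_l\ge 1}}\binom{n_{j_1}}{\alpha_1}\cdots\binom{n_{j_l}}{\alpha_l} & \text{if } d=i+1,\\ 0 & \text{if } d\ne i+1.\end{cases}$$ (3) Let $n\ge 0$ be an integer and let $S_n$ be the star graph with $n+1$ vertices $x,y_1,\dots,y_n$ and the $n$ edges $\{x,y_1\},\dots,\{x,y_n\}$. Then $\beta_i(S_n)=\binom ni$ for all $i\ge 0$, and $\mathrm{pd}(S_n)=n$. In particular these numbers do not depend on $k$. -/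

import Mathlib

noncomputable section

namespace GraphBetti

open MvPolynomial CategoryTheory

/-- The graph ideal `I(G)`: the ideal of the polynomial ring on the vertices of `G` generated
by the products `x_u x_v` over all edges `{u, v}` of `G`. -/
def graphIdeal {V : Type*} (k : Type*) [Field k] (G : SimpleGraph V) :
    Ideal (MvPolynomial V k) :=
  Ideal.span {p | ∃ u v, G.Adj u v ∧ p = X u * X v}

section Graded

variable {V : Type*} {k : Type*} [Field k]

/-- Let the `b`-th basis vector of the free module `R^r`, `R = k[x_v | v ∈ V]`, have multidegree
`deg b`. A vector of `R^r` is homogeneous of multidegree `c` if every monomial `x^m` occurring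
in its `b`-th coordinate satisfies `m + deg b = c`. -/
def IsHomogeneousVec {r : ℕ} (deg : Fin r → V →₀ ℕ) (c : V →₀ ℕ)
    (f : Fin r → MvPolynomial V k) : Prop :=
  ∀ b, ∀ m ∈ (f b).support, m + deg b = c

/-- A multigraded (that is, `ℕ^V`-graded) free resolution, by finitely generated free modules,
of the `R`-module `R/I`, `R = k[x_v | v ∈ V]`:
`⋯ → F₂ → F₁ → F₀ → R/I → 0`, where `F_i = R^(rank i)` has a basis whose `b`-th element is
homogeneous of multidegree `deg i b`, and all the maps are homogeneous of degree `0`. -/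
structure MultigradedFreeResolution (I : Ideal (MvPolynomial V k)) where
  /-- The rank of `F_i`. -/
  rank : ℕ → ℕ
  /-- The multidegrees of the basis elements of `F_i`. -/
  deg : ∀ i, Fin (rank i) → V →₀ ℕ
  /-- The differential `F_{i+1} → F_i`. -/
  d : ∀ i, (Fin (rank (i + 1)) → MvPolynomial V k) →ₗ[MvPolynomial V k]
    (Fin (rank i) → MvPolynomial V k)
  /-- The augmentation `F_0 → R/I`. -/
  aug : (Fin (rank 0) → MvPolynomial V k) →ₗ[MvPolynomial V k] (MvPolynomial V k ⧸ I)
  d_homogeneous : ∀ i b, IsHomogeneousVec (deg i) (deg (i + 1) b) (d i (Pi.single b 1))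
  aug_homogeneous : ∀ b, ∃ a : k,
    aug (Pi.single b 1) = Ideal.Quotient.mk I (monomial (deg 0 b) a)
  aug_surjective : Function.Surjective aug
  exact_zero : Function.Exact (d 0) aug
  exact_succ : ∀ i, Function.Exact (d (i + 1)) (d i)

namespace MultigradedFreeResolution

variable {I : Ideal (MvPolynomial V k)} (F : MultigradedFreeResolution I)

open Classical in
/-- The part of multidegree `a` of the differential `F_{i+1} ⊗_R k → F_i ⊗_R k`, where
`k = R/⟨x_v | v ∈ V⟩`. The vector space `(F_i ⊗_R k)_a` has as basis the basis elements of `F_i`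
of multidegree `a`, and the matrix of the map consists of the constant terms of the entries of
the matrix of `F_{i+1} → F_i`. -/
def tensorD (a : V →₀ ℕ) (i : ℕ) :
    ({b : Fin (F.rank (i + 1)) // F.deg (i + 1) b = a} → k) →ₗ[k]
      ({b : Fin (F.rank i) // F.deg i b = a} → k) :=
  Matrix.mulVecLin (Matrix.of fun b b' => constantCoeff (F.d i (Pi.single b'.1 1) b.1))

/-- The cycles of `(F_i ⊗_R k)_a`. -/
def cycles (a : V →₀ ℕ) : ∀ i, Submodule k ({b : Fin (F.rank i) // F.deg i b = a} → k)
  | 0 => ⊤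
  | i + 1 => LinearMap.ker (F.tensorD a i)

/-- The boundaries of `(F_i ⊗_R k)_a`. -/
def boundaries (a : V →₀ ℕ) (i : ℕ) :
    Submodule k ({b : Fin (F.rank i) // F.deg i b = a} → k) :=
  LinearMap.range (F.tensorD a i)

/-- `Tor_i^R(R/I, k)_a`, computed from the resolution `F`: the `i`-th homology of the
multidegree `a` part of the complex `F ⊗_R k`. -/
abbrev gradedTor (a : V →₀ ℕ) (i : ℕ) : Type _ :=
  F.cycles a i ⧸ (F.boundaries a i).submoduleOf (F.cycles a i)

end MultigradedFreeResolution

/-! ### Existence of multigraded free resolutions -/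

/-- The component of multidegree `c` of a vector. -/
def component {r : ℕ} (deg : Fin r → V →₀ ℕ) (c : V →₀ ℕ) (f : Fin r → MvPolynomial V k) :
    Fin r → MvPolynomial V k := by
  classical
  exact fun b => ∑ m ∈ (f b).support with m + deg b = c, monomial m (coeff m (f b))

open Classical in
theorem coeff_component {r : ℕ} (deg : Fin r → V →₀ ℕ) (c : V →₀ ℕ)
    (f : Fin r → MvPolynomial V k) (b : Fin r) (m : V →₀ ℕ) :
    coeff m (component deg c f b) = if m + deg b = c then coeff m (f b) else 0 := by
  simp only [component, coeff_sum, coeff_monomial, Finset.sum_ite_eq', Finset.mem_filter,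
    mem_support_iff]
  by_cases h : m + deg b = c <;> by_cases h' : coeff m (f b) = 0 <;> simp [h, h']

theorem component_add {r : ℕ} (deg : Fin r → V →₀ ℕ) (c : V →₀ ℕ)
    (f g : Fin r → MvPolynomial V k) :
    component deg c (f + g) = component deg c f + component deg c g := by
  classical
  ext b m
  simp only [coeff_component, Pi.add_apply, coeff_add]
  split_ifs <;> simp

theorem component_homogeneous {r : ℕ} (deg : Fin r → V →₀ ℕ) (c : V →₀ ℕ)
    (f : Fin r → MvPolynomial V k) : IsHomogeneousVec deg c (component deg c f) := by
  classical
  intro b m hm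
  rw [mem_support_iff, coeff_component] at hm
  by_contra h
  simp [h] at hm

open Classical in
theorem component_of_homogeneous {r : ℕ} {deg : Fin r → V →₀ ℕ} {c c' : V →₀ ℕ}
    {f : Fin r → MvPolynomial V k} (hf : IsHomogeneousVec deg c' f) :
    component deg c f = if c' = c then f else 0 := by
  ext b m
  rw [coeff_component]
  by_cases h' : coeff m (f b) = 0
  · split_ifs <;> simp [h']
  · have := hf b m (mem_support_iff.2 h')
    rw [this]
    split_ifs <;> simp

theorem IsHomogeneousVec.monomial_smul {r : ℕ} {deg : Fin r → V →₀ ℕ} {c : V →₀ ℕ}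
    {f : Fin r → MvPolynomial V k} (hf : IsHomogeneousVec deg c f) (m : V →₀ ℕ) (a : k) :
    IsHomogeneousVec deg (m + c) (monomial m a • f) := by
  classical
  intro b n hn
  rw [mem_support_iff, Pi.smul_apply, smul_eq_mul, coeff_monomial_mul'] at hn
  split_ifs at hn with h
  · have h1 := hf b (n - m) (mem_support_iff.2 (right_ne_zero_of_mul hn))
    rw [← h1, ← add_assoc, add_tsub_cancel_of_le h]
  · exact absurd rfl hn

theorem isHomogeneousVec_single {r : ℕ} (deg : Fin r → V →₀ ℕ) (b : Fin r) :
    IsHomogeneousVec deg (deg b) (Pi.single b (1 : MvPolynomial V k)) := by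
  classical
  intro b' m hm
  rw [mem_support_iff] at hm
  by_cases h : b' = b
  · subst h
    rw [Pi.single_eq_same, coeff_one] at hm
    have : 0 = m := by by_contra h0; simp [h0] at hm
    simp [← this]
  · simp [Pi.single_eq_of_ne h] at hm

/-- A map that sends the basis to homogeneous vectors commutes with taking components. -/
theorem map_component {r s : ℕ} {deg : Fin r → V →₀ ℕ} {deg' : Fin s → V →₀ ℕ}
    (φ : (Fin s → MvPolynomial V k) →ₗ[MvPolynomial V k] (Fin r → MvPolynomial V k))
    (hφ : ∀ b, IsHomogeneousVec deg (deg' b) (φ (Pi.single b 1))) (c : V →₀ ℕ)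
    (f : Fin s → MvPolynomial V k) :
    φ (component deg' c f) = component deg c (φ f) := by
  classical
  have key : ∀ b (p : MvPolynomial V k), φ (component deg' c (Pi.single b p)) =
      component deg c (φ (Pi.single b p)) := by
    intro b p
    induction p using MvPolynomial.induction_on' with
    | monomial m a =>
      have h : (Pi.single b (monomial m a) : Fin s → MvPolynomial V k)
          = monomial m a • Pi.single b 1 := by
        rw [← Pi.single_smul, smul_eq_mul, mul_one]
      rw [h, map_smul, component_of_homogeneous ((hφ b).monomial_smul m a),
        component_of_homogeneous ((isHomogeneousVec_single deg' b).monomial_smul m a)]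
      split_ifs <;> simp
    | add p q hp hq =>
      rw [Pi.single_add, component_add, map_add, map_add, component_add, hp, hq]
  have h0 : ∀ {t : ℕ} (e : Fin t → V →₀ ℕ),
      component e c (0 : Fin t → MvPolynomial V k) = 0 := by
    intro t e; ext b m; simp [coeff_component]
  rw [← Finset.univ_sum_single f]
  induction (Finset.univ : Finset (Fin s)) using Finset.induction_on with
  | empty => simp [h0]
  | insert b T hb ih =>
    rw [Finset.sum_insert hb, component_add, map_add, map_add, component_add, ih, key]

/-- A submodule is homogeneous if it contains the components of its elements. -/
def IsHomogeneousSubmodule {r : ℕ} (deg : Fin r → V →₀ ℕ)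
    (N : Submodule (MvPolynomial V k) (Fin r → MvPolynomial V k)) : Prop :=
  ∀ f ∈ N, ∀ c, component deg c f ∈ N

theorem eq_sum_component {r : ℕ} (deg : Fin r → V →₀ ℕ) (f : Fin r → MvPolynomial V k) :
    ∃ T : Finset (V →₀ ℕ), f = ∑ c ∈ T, component deg c f := by
  classical
  refine ⟨Finset.univ.biUnion fun b => (f b).support.image (· + deg b), ?_⟩
  ext b m
  rw [Finset.sum_apply, coeff_sum]
  simp only [coeff_component]
  rw [Finset.sum_ite_eq]
  by_cases h' : coeff m (f b) = 0
  · simp [h']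
  · rw [if_pos]
    exact Finset.mem_biUnion.2 ⟨b, Finset.mem_univ _,
      Finset.mem_image.2 ⟨m, mem_support_iff.2 h', rfl⟩⟩

/-- A homogeneous submodule of `R^r` is the image of a homogeneous map `R^s → R^r`. -/
theorem exists_cover [Finite V] {r : ℕ} (deg : Fin r → V →₀ ℕ)
    (N : Submodule (MvPolynomial V k) (Fin r → MvPolynomial V k))
    (hN : IsHomogeneousSubmodule deg N) :
    ∃ (s : ℕ) (deg' : Fin s → V →₀ ℕ)
      (φ : (Fin s → MvPolynomial V k) →ₗ[MvPolynomial V k] (Fin r → MvPolynomial V k)),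
      (∀ b, IsHomogeneousVec deg (deg' b) (φ (Pi.single b 1))) ∧ LinearMap.range φ = N := by
  classical
  set S : Set (Fin r → MvPolynomial V k) := {f | f ∈ N ∧ ∃ c, IsHomogeneousVec deg c f} with hS
  have hspan : Submodule.span (MvPolynomial V k) S = N := by
    apply le_antisymm
    · exact Submodule.span_le.2 fun f hf => hf.1
    · intro f hf
      obtain ⟨T, hT⟩ := eq_sum_component deg f
      rw [hT]
      exact Submodule.sum_mem _ fun c _ =>
        Submodule.subset_span ⟨hN f hf c, c, component_homogeneous deg c f⟩
  obtain ⟨S', hS', hS'span⟩ := (Submodule.fg_span_iff_fg_span_finset_subset S).1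
    (IsNoetherian.noetherian (Submodule.span (MvPolynomial V k) S))
  have hmem : ∀ b : Fin S'.card, ((S'.equivFin.symm b : S') : Fin r → MvPolynomial V k) ∈ S :=
    fun b => hS' (S'.equivFin.symm b).2
  choose deg' hdeg' using fun b => (hmem b).2
  refine ⟨S'.card, deg', Fintype.linearCombination (MvPolynomial V k)
    (fun b => ((S'.equivFin.symm b : S') : Fin r → MvPolynomial V k)), ?_, ?_⟩
  · intro b
    rw [Fintype.linearCombination_apply_single, one_smul]
    exact hdeg' b
  · rw [Fintype.range_linearCombination, ← hspan, hS'span]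
    congr 1
    ext f
    constructor
    · rintro ⟨b, rfl⟩
      exact (S'.equivFin.symm b).2
    · intro hf
      exact ⟨S'.equivFin ⟨f, hf⟩, by simp⟩

theorem ker_homogeneous {r s : ℕ} {deg : Fin r → V →₀ ℕ} {deg' : Fin s → V →₀ ℕ}
    (φ : (Fin s → MvPolynomial V k) →ₗ[MvPolynomial V k] (Fin r → MvPolynomial V k))
    (hφ : ∀ b, IsHomogeneousVec deg (deg' b) (φ (Pi.single b 1))) :
    IsHomogeneousSubmodule deg' (LinearMap.ker φ) := by
  intro f hf c
  rw [LinearMap.mem_ker] at hf ⊢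
  rw [map_component φ hφ, hf]
  ext b m
  classical
  simp [coeff_component]

/-- A stage of the construction of a resolution: a homogeneous submodule of a graded free
module. -/
structure Stage (V : Type*) (k : Type*) [Field k] where
  r : ℕ
  deg : Fin r → V →₀ ℕ
  N : Submodule (MvPolynomial V k) (Fin r → MvPolynomial V k)
  hN : IsHomogeneousSubmodule deg N

namespace Stage

variable [Finite V] (S : Stage V k)

/-- The rank of a graded free module that maps onto `S.N`. -/
def coverRank : ℕ := (exists_cover S.deg S.N S.hN).choose

/-- The multidegrees of the basis of a graded free module that maps onto `S.N`. -/
def coverDeg : Fin S.coverRank → V →₀ ℕ := (exists_cover S.deg S.N S.hN).choose_spec.choose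

/-- A homogeneous map onto `S.N`. -/
def cover : (Fin S.coverRank → MvPolynomial V k) →ₗ[MvPolynomial V k]
    (Fin S.r → MvPolynomial V k) :=
  (exists_cover S.deg S.N S.hN).choose_spec.choose_spec.choose

theorem cover_homogeneous :
    ∀ b, IsHomogeneousVec S.deg (S.coverDeg b) (S.cover (Pi.single b 1)) :=
  (exists_cover S.deg S.N S.hN).choose_spec.choose_spec.choose_spec.1

theorem range_cover : LinearMap.range S.cover = S.N :=
  (exists_cover S.deg S.N S.hN).choose_spec.choose_spec.choose_spec.2

/-- The next stage: the kernel of `S.cover`. -/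
def next : Stage V k where
  r := S.coverRank
  deg := S.coverDeg
  N := LinearMap.ker S.cover
  hN := ker_homogeneous S.cover S.cover_homogeneous

/-- The sequence of stages starting with `S`. -/
def seq : ℕ → Stage V k
  | 0 => S
  | i + 1 => (seq i).next

end Stage

/-- The graph ideal is a multihomogeneous submodule of `R = R^1`. -/
theorem graphIdeal_homogeneous (G : SimpleGraph V) :
    IsHomogeneousSubmodule (fun _ : Fin 1 => (0 : V →₀ ℕ))
      (LinearMap.ker ((Ideal.Quotient.mkₐ (MvPolynomial V k) (graphIdeal k G)).toLinearMap ∘ₗ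
        (LinearMap.proj 0 : (Fin 1 → MvPolynomial V k) →ₗ[MvPolynomial V k] _))) := by
  classical
  have hI : graphIdeal k G = Ideal.span ((fun s => monomial s (1 : k)) ''
      {s | ∃ u v, G.Adj u v ∧ s = Finsupp.single u 1 + Finsupp.single v 1}) := by
    unfold graphIdeal
    congr 1
    ext p
    constructor
    · rintro ⟨u, v, h, rfl⟩
      exact ⟨_, ⟨u, v, h, rfl⟩, by simp [X, monomial_mul]⟩
    · rintro ⟨_, ⟨u, v, h, rfl⟩, rfl⟩
      exact ⟨u, v, h, by simp [X, monomial_mul]⟩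
  intro f hf c
  simp only [LinearMap.mem_ker, LinearMap.comp_apply, LinearMap.proj_apply,
    AlgHom.toLinearMap_apply, Ideal.Quotient.mkₐ_eq_mk, Ideal.Quotient.eq_zero_iff_mem] at hf ⊢
  rw [hI, mem_ideal_span_monomial_image] at hf ⊢
  intro m hm
  apply hf m
  rw [mem_support_iff] at hm ⊢
  intro h
  apply hm
  rw [coeff_component, h, ite_self]

/-- Every finite graph has a multigraded free resolution of `R/I(G)`. -/
theorem nonempty_resolution [Finite V] (G : SimpleGraph V) :
    Nonempty (MultigradedFreeResolution (graphIdeal k G)) := by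
  let S : Stage V k := ⟨1, _, _, graphIdeal_homogeneous (k := k) G⟩
  refine ⟨{
    rank := fun i => (S.seq i).r
    deg := fun i => (S.seq i).deg
    d := fun i => (S.seq i).cover
    aug := (Ideal.Quotient.mkₐ (MvPolynomial V k) (graphIdeal k G)).toLinearMap ∘ₗ
        (LinearMap.proj 0 : (Fin 1 → MvPolynomial V k) →ₗ[MvPolynomial V k] _)
    d_homogeneous := fun i b => (S.seq i).cover_homogeneous b
    aug_homogeneous := ?_
    aug_surjective := ?_
    exact_zero := ?_
    exact_succ := ?_ }⟩
  · intro b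
    refine ⟨1, ?_⟩
    obtain rfl : b = (0 : Fin 1) := Subsingleton.elim (α := Fin 1) _ _
    change Ideal.Quotient.mk _ ((Pi.single (0 : Fin 1) (1 : MvPolynomial V k) :
      Fin 1 → MvPolynomial V k) 0) = _
    rw [Pi.single_eq_same]
    rfl
  · intro y
    obtain ⟨p, rfl⟩ := Ideal.Quotient.mk_surjective y
    exact ⟨fun _ => p, rfl⟩
  · intro x
    exact (SetLike.ext_iff.1 S.range_cover x).symm
  · intro i x
    exact (SetLike.ext_iff.1 (S.seq (i + 1)).range_cover x).symm

end Graded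

section Betti

variable {V : Type*} [Fintype V] (k : Type*) [Field k] (G : SimpleGraph V)

/-- A multigraded free resolution of `R/I(G)`. -/
def resolution : MultigradedFreeResolution (graphIdeal k G) := (nonempty_resolution G).some

/-- The multigraded Betti number `β_{i,a}(G) = dim_k Tor_i^R(R/I(G), k)_a`, `a ∈ ℕ^V`. -/
def multigradedBetti (i : ℕ) (a : V →₀ ℕ) : ℕ :=
  Module.finrank k ((resolution k G).gradedTor a i)

open Classical in
/-- The `ℕ`-graded Betti number `β_{i,d}(G) = ∑_{|a| = d} β_{i,a}(G)`. -/
def gradedBetti (i d : ℕ) : ℕ :=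
  ∑ a ∈ (Finset.univ : Finset V).finsuppAntidiag d, multigradedBetti k G i a

/-- The `R`-module `R/I(G)`. -/
abbrev graphModule : ModuleCat (MvPolynomial V k) :=
  ModuleCat.of (MvPolynomial V k) (MvPolynomial V k ⧸ graphIdeal k G)

/-- The field `k` as the `R`-module `R/⟨x_v | v ∈ V⟩`. -/
abbrev residueModule (V : Type*) (k : Type*) [Field k] : ModuleCat (MvPolynomial V k) :=
  ModuleCat.of (MvPolynomial V k)
    (MvPolynomial V k ⧸ Ideal.span (Set.range (X : V → MvPolynomial V k)))

/-- The total Betti number `β_i(G) = dim_k Tor_i^R(k, R/I(G))`. -/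
def betti (i : ℕ) : Cardinal :=
  Module.rank k ((ModuleCat.restrictScalars (MvPolynomial.C (σ := V) (R := k))).obj
    (((Tor (ModuleCat (MvPolynomial V k)) i).obj (residueModule V k)).obj (graphModule k G)))

/-- The projective dimension of `G`, that is, of the `R`-module `R/I(G)`. -/
def projDim : WithBot ℕ∞ := projectiveDimension (graphModule k G)

end Betti

end GraphBetti

end

/-! All three families are complete multipartite graphs: with a colouring `c` of the vertices, `u`
and `v` are adjacent iff `c u ≠ c v`. The star is the bipartite case with a class of one vertex. So
one explicit minimal resolution settles everything.

Order the vertices and then the edges `(u, v)`, `u < v`, lexicographically. The edge monomials have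
linear quotients: the colon of the ideal of the preceding edges by `x_u x_v` is generated by
variables, namely the `x_w` with `w < u`, or `w < v` and `c w ≠ c u` (`exists_edgeExponent_le_iff`).
Adding one edge at a time, the mapping cone of a Koszul complex over the resolution built so far
resolves the larger ideal (`CyclicResolution.exists_mappingCone`). The result is linear, hence
minimal, and an edge `e` contributes `choose (colonVars c e).card i` generators to step `i + 1`.

A bijection (`sum_choose_card_colonVars`) turns the sum of these numbers into `multipartiteCount c
(i + 2)`: each set `U` of `i + 2` vertices counts with the number of classes it meets, minus one.
Sorting the `U` by the classes met and by the number of vertices in each gives the stated formulas.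

It remains to read invariants off this resolution. The graded Betti numbers are defined by a chosen
resolution that need not be minimal, so a multigraded comparison theorem is needed
(`MultigradedFreeResolution.finrank_gradedTor`). The total Betti numbers and the projective
dimension are the categorical ones: all differentials vanish after tensoring with the residue field
(`HasDistinctDegrees.torIso`), and syzygies of a minimal resolution are not projective before its
end (`HasDistinctDegrees.projectiveDimension_eq`). The field never enters the counts. -/

noncomputable section

namespace GraphBetti

open MvPolynomial CategoryTheory

/-! ### Homogeneous vectors and maps over arbitrary finite bases -/

section HomogeneousMaps

variable {V k : Type*} [Field k] {α β γ : Type}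

/-- Homogeneous vectors of a multigraded free module with an arbitrary indexed basis. -/
def IsHomogVec (deg : α → V →₀ ℕ) (c : V →₀ ℕ) (f : α → MvPolynomial V k) : Prop :=
  ∀ b, ∀ m ∈ (f b).support, m + deg b = c

/-- Homogeneous maps of degree `0` between multigraded free modules. -/
def IsHomogMap [DecidableEq α] (deg : α → V →₀ ℕ) (deg' : β → V →₀ ℕ)
    (φ : (α → MvPolynomial V k) →ₗ[MvPolynomial V k] (β → MvPolynomial V k)) : Prop :=
  ∀ b, IsHomogVec deg' (deg b) (φ (Pi.single b 1))

open Classical in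
/-- The component of multidegree `c` of a vector. -/
def homogComponent (deg : α → V →₀ ℕ) (c : V →₀ ℕ) :
    (α → MvPolynomial V k) →ₗ[k] (α → MvPolynomial V k) :=
  -- In coordinate `b` at most one monomial has the right degree, namely `c - deg b`; extracting its
  -- coefficient is visibly `k`-linear.
  LinearMap.pi fun b => if deg b ≤ c then
    (monomial (c - deg b)).comp ((lcoeff k (c - deg b)).comp (LinearMap.proj b)) else 0

open Classical in
theorem coeff_homogComponent (deg : α → V →₀ ℕ) (c : V →₀ ℕ) (f : α → MvPolynomial V k)
    (b : α) (m : V →₀ ℕ) :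
    coeff m (homogComponent deg c f b) = if m + deg b = c then coeff m (f b) else 0 := by
  by_cases h : deg b ≤ c
  · have h' : m + deg b = c ↔ c - deg b = m := by
      rw [tsub_eq_iff_eq_add_of_le h, eq_comm]
    by_cases h'' : c - deg b = m
    · simp [homogComponent, h, h', h'']
    · simp [homogComponent, h, h', h'', coeff_monomial]
  · have h' : m + deg b ≠ c := fun e => h (e ▸ le_add_self)
    simp [homogComponent, h, h']

/-- Being a fixed point of a linear projection is a linear condition, so closure under sums,
negatives and homogeneous maps becomes rewriting. -/
theorem isHomogVec_iff {deg : α → V →₀ ℕ} {c : V →₀ ℕ} {f : α → MvPolynomial V k} :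
    IsHomogVec deg c f ↔ homogComponent deg c f = f := by
  classical
  constructor
  · intro h
    ext b m
    rw [coeff_homogComponent]
    split_ifs with h1
    · rfl
    · by_contra h2
      exact h1 (h b m (mem_support_iff.2 fun e => h2 e.symm))
  · intro h b m hm
    by_contra h1
    rw [mem_support_iff, ← h, coeff_homogComponent, if_neg h1] at hm
    exact hm rfl

theorem isHomogVec_homogComponent (deg : α → V →₀ ℕ) (c : V →₀ ℕ) (f : α → MvPolynomial V k) :
    IsHomogVec deg c (homogComponent deg c f) := by
  classical
  rw [isHomogVec_iff]
  ext b m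
  simp only [coeff_homogComponent]
  split_ifs <;> rfl

theorem isHomogVec_basis [DecidableEq α] (deg : α → V →₀ ℕ) (b : α) :
    IsHomogVec deg (deg b) (Pi.single b (1 : MvPolynomial V k)) := by
  classical
  intro b' m hm
  rw [mem_support_iff] at hm
  by_cases h : b' = b
  · subst h
    rw [Pi.single_eq_same, coeff_one] at hm
    have : 0 = m := by by_contra h0; simp [h0] at hm
    simp [← this]
  · simp [Pi.single_eq_of_ne h] at hm

theorem homogComponent_of_isHomogVec_of_ne {deg : α → V →₀ ℕ} {c c' : V →₀ ℕ} (hc : c' ≠ c)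
    {f : α → MvPolynomial V k} (hf : IsHomogVec deg c' f) : homogComponent deg c f = 0 := by
  classical
  ext b m
  rw [coeff_homogComponent]
  split_ifs with h
  · by_contra h'
    exact hc ((hf b m (mem_support_iff.2 h')).symm.trans h)
  · rfl

theorem IsHomogVec.monomial_smul {deg : α → V →₀ ℕ} {c : V →₀ ℕ}
    {f : α → MvPolynomial V k} (hf : IsHomogVec deg c f) (m : V →₀ ℕ) (a : k) :
    IsHomogVec deg (m + c) (monomial m a • f) := by
  classical
  intro b n hn
  rw [mem_support_iff, Pi.smul_apply, smul_eq_mul, coeff_monomial_mul'] at hn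
  split_ifs at hn with h
  · have h1 := hf b (n - m) (mem_support_iff.2 (right_ne_zero_of_mul hn))
    rw [← h1, ← add_assoc, add_tsub_cancel_of_le h]
  · exact absurd rfl hn

theorem IsHomogVec.add {deg : α → V →₀ ℕ} {c : V →₀ ℕ}
    {f g : α → MvPolynomial V k} (hf : IsHomogVec deg c f) (hg : IsHomogVec deg c g) :
    IsHomogVec deg c (f + g) := by
  rw [isHomogVec_iff] at *
  rw [map_add, hf, hg]

theorem IsHomogVec.neg {deg : α → V →₀ ℕ} {c : V →₀ ℕ}
    {f : α → MvPolynomial V k} (hf : IsHomogVec deg c f) : IsHomogVec deg c (-f) := by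
  rw [isHomogVec_iff] at *
  rw [map_neg, hf]

variable [DecidableEq α]

/-- Both sides are `k`-linear in `f`, so it suffices to test monomial multiples of basis vectors.
These are homogeneous, and so are their images, of the same degree. -/
theorem IsHomogMap.map_homogComponent [Finite α] {deg : α → V →₀ ℕ} {deg' : β → V →₀ ℕ}
    {φ : (α → MvPolynomial V k) →ₗ[MvPolynomial V k] (β → MvPolynomial V k)}
    (hφ : IsHomogMap deg deg' φ) (c : V →₀ ℕ) (f : α → MvPolynomial V k) :
    φ (homogComponent deg c f) = homogComponent deg' c (φ f) := by
  have key : (φ.restrictScalars k).comp (homogComponent deg c) =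
      (homogComponent deg' c).comp (φ.restrictScalars k) := by
    refine LinearMap.pi_ext' fun b => MvPolynomial.linearMap_ext fun m => LinearMap.ext fun a => ?_
    have h : (Pi.single b (monomial m a) : α → MvPolynomial V k)
        = monomial m a • Pi.single b 1 := by
      rw [← Pi.single_smul, smul_eq_mul, mul_one]
    simp only [LinearMap.comp_apply, LinearMap.single_apply, LinearMap.restrictScalars_apply, h]
    have h1 := (isHomogVec_basis (k := k) deg b).monomial_smul m a
    have h2 := (hφ b).monomial_smul m a
    by_cases hc : m + deg b = c
    · subst hc
      rw [φ.map_smul, isHomogVec_iff.1 h1, isHomogVec_iff.1 h2, φ.map_smul]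
    · rw [φ.map_smul, homogComponent_of_isHomogVec_of_ne hc h1,
        homogComponent_of_isHomogVec_of_ne hc h2, map_zero]
  exact LinearMap.congr_fun key f

theorem IsHomogMap.map_isHomogVec [Finite α] {deg : α → V →₀ ℕ} {deg' : β → V →₀ ℕ}
    {φ : (α → MvPolynomial V k) →ₗ[MvPolynomial V k] (β → MvPolynomial V k)}
    (hφ : IsHomogMap deg deg' φ) {c : V →₀ ℕ} {f : α → MvPolynomial V k}
    (hf : IsHomogVec deg c f) : IsHomogVec deg' c (φ f) := by
  rw [isHomogVec_iff] at hf ⊢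
  rw [← hφ.map_homogComponent, hf]

theorem IsHomogMap.id (deg : α → V →₀ ℕ) :
    IsHomogMap deg deg (LinearMap.id : (α → MvPolynomial V k) →ₗ[MvPolynomial V k] _) :=
  fun b => isHomogVec_basis deg b

theorem IsHomogMap.comp [Finite β] [DecidableEq β] {deg : α → V →₀ ℕ} {deg' : β → V →₀ ℕ}
    {deg'' : γ → V →₀ ℕ}
    {ψ : (β → MvPolynomial V k) →ₗ[MvPolynomial V k] (γ → MvPolynomial V k)}
    {φ : (α → MvPolynomial V k) →ₗ[MvPolynomial V k] (β → MvPolynomial V k)}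
    (hψ : IsHomogMap deg' deg'' ψ) (hφ : IsHomogMap deg deg' φ) :
    IsHomogMap deg deg'' (ψ ∘ₗ φ) :=
  fun b => hψ.map_isHomogVec (hφ b)

theorem IsHomogMap.sub {deg : α → V →₀ ℕ} {deg' : β → V →₀ ℕ}
    {φ ψ : (α → MvPolynomial V k) →ₗ[MvPolynomial V k] (β → MvPolynomial V k)}
    (hφ : IsHomogMap deg deg' φ) (hψ : IsHomogMap deg deg' ψ) :
    IsHomogMap deg deg' (φ - ψ) := fun b => by
  rw [LinearMap.sub_apply, sub_eq_add_neg]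
  exact (hφ b).add (hψ b).neg

/-- Homogeneous maps out of a free module lift along homogeneous maps. -/
theorem IsHomogMap.exists_lift [Finite α] [Finite γ] [DecidableEq γ] {deg : α → V →₀ ℕ}
    {deg' : β → V →₀ ℕ} {deg'' : γ → V →₀ ℕ}
    {φ : (α → MvPolynomial V k) →ₗ[MvPolynomial V k] (β → MvPolynomial V k)}
    (hφ : IsHomogMap deg deg' φ)
    {f : (γ → MvPolynomial V k) →ₗ[MvPolynomial V k] (β → MvPolynomial V k)}
    (hf : IsHomogMap deg'' deg' f) (hle : ∀ x, f x ∈ LinearMap.range φ) :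
    ∃ g : (γ → MvPolynomial V k) →ₗ[MvPolynomial V k] (α → MvPolynomial V k),
      IsHomogMap deg'' deg g ∧ φ ∘ₗ g = f := by
  have := Fintype.ofFinite γ
  -- An arbitrary preimage of `f e_b` can be replaced by its component of degree `deg'' b`: `φ`
  -- commutes with components and `f e_b` is its own component.
  choose p hp using fun b : γ => hle (Pi.single b 1)
  refine ⟨Fintype.linearCombination (MvPolynomial V k)
    fun b => homogComponent deg (deg'' b) (p b), ?_, ?_⟩
  · intro b
    rw [Fintype.linearCombination_apply_single, one_smul]
    exact isHomogVec_homogComponent _ _ _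
  · refine LinearMap.pi_ext' fun b => LinearMap.ext_ring ?_
    simp only [LinearMap.comp_apply, LinearMap.single_apply]
    rw [Fintype.linearCombination_apply_single, one_smul, hφ.map_homogComponent, hp,
      isHomogVec_iff.1 (hf b)]

end HomogeneousMaps

/-! ### Reduction modulo the variables, in one multidegree -/

section Reduction

variable {V k : Type*} [Field k] {α β γ : Type}

open Classical in
/-- The block of multidegree `a` of the matrix of constant terms of a map of free modules. -/
def reduction [Fintype α] [DecidableEq α] (deg : α → V →₀ ℕ) (deg' : β → V →₀ ℕ) (a : V →₀ ℕ)
    (φ : (α → MvPolynomial V k) →ₗ[MvPolynomial V k] (β → MvPolynomial V k)) :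
    ({b : α // deg b = a} → k) →ₗ[k] ({b : β // deg' b = a} → k) :=
  Matrix.mulVecLin (Matrix.of fun b b' => constantCoeff (φ (Pi.single b'.1 1) b.1))

theorem constantCoeff_comp_basis [Fintype β] [DecidableEq α] [DecidableEq β]
    (ψ : (β → MvPolynomial V k) →ₗ[MvPolynomial V k] (γ → MvPolynomial V k))
    (φ : (α → MvPolynomial V k) →ₗ[MvPolynomial V k] (β → MvPolynomial V k)) (b : α) (c : γ) :
    constantCoeff (ψ (φ (Pi.single b 1)) c) =
      ∑ e, constantCoeff (ψ (Pi.single e 1) c) * constantCoeff (φ (Pi.single b 1) e) := by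
  conv_lhs => rw [← Finset.univ_sum_single (φ (Pi.single b 1))]
  rw [map_sum, Finset.sum_apply, map_sum]
  refine Finset.sum_congr rfl fun e _ => ?_
  have h : ∀ q : MvPolynomial V k, (Pi.single e q : β → MvPolynomial V k) = q • Pi.single e 1 := by
    intro q
    rw [← Pi.single_smul, smul_eq_mul, mul_one]
  rw [h, map_smul, Pi.smul_apply, smul_eq_mul, map_mul, mul_comm]

/-- A constant term is the monomial of exponent `0`, which homogeneity allows only between basis
elements of equal degree. -/
theorem IsHomogMap.constantCoeff_eq_zero [DecidableEq α] {deg : α → V →₀ ℕ} {deg' : β → V →₀ ℕ}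
    {φ : (α → MvPolynomial V k) →ₗ[MvPolynomial V k] (β → MvPolynomial V k)}
    (hφ : IsHomogMap deg deg' φ) {b : α} {c : β} (h : deg b ≠ deg' c) :
    constantCoeff (φ (Pi.single b 1) c) = 0 := by
  by_contra h0
  have := hφ b c 0 (mem_support_iff.2 h0)
  rw [zero_add] at this
  exact h this.symm

/-- The full matrix product sums over all middle indices, the product of blocks only over those of
degree `a`; the hypothesis kills the difference. -/
theorem reduction_comp_of_forall [Fintype α] [DecidableEq α] [Fintype β]
    [DecidableEq β] {deg : α → V →₀ ℕ} {deg' : β → V →₀ ℕ} {deg'' : γ → V →₀ ℕ}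
    (a : V →₀ ℕ)
    {ψ : (β → MvPolynomial V k) →ₗ[MvPolynomial V k] (γ → MvPolynomial V k)}
    {φ : (α → MvPolynomial V k) →ₗ[MvPolynomial V k] (β → MvPolynomial V k)}
    (h : ∀ b c e, deg b = a → deg'' c = a → deg' e ≠ a →
      constantCoeff (ψ (Pi.single e 1) c) * constantCoeff (φ (Pi.single b 1) e) = 0) :
    reduction deg deg'' a (ψ ∘ₗ φ) = reduction deg' deg'' a ψ ∘ₗ reduction deg deg' a φ := by
  classical
  unfold reduction
  rw [← Matrix.mulVecLin_mul]
  congr 1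
  ext c b
  rw [Matrix.mul_apply, Matrix.of_apply, LinearMap.comp_apply, constantCoeff_comp_basis]
  simp only [Matrix.of_apply]
  rw [← Finset.sum_filter_of_ne (p := fun e => deg' e = a)]
  · exact Finset.sum_subtype _ (by simp) _
  · intro e _ he
    by_contra h'
    exact he (h _ _ _ b.2 c.2 h')

/-- Homogeneity of one factor is enough to kill the middle terms of the wrong degree. This is why
homotopies can be used below without recording that they are homogeneous. -/
theorem IsHomogMap.reduction_comp [Fintype α] [DecidableEq α] [Fintype β]
    [DecidableEq β] {deg : α → V →₀ ℕ} {deg' : β → V →₀ ℕ} {deg'' : γ → V →₀ ℕ}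
    (a : V →₀ ℕ)
    {ψ : (β → MvPolynomial V k) →ₗ[MvPolynomial V k] (γ → MvPolynomial V k)}
    {φ : (α → MvPolynomial V k) →ₗ[MvPolynomial V k] (β → MvPolynomial V k)}
    (h : IsHomogMap deg deg' φ ∨ IsHomogMap deg' deg'' ψ) :
    reduction deg deg'' a (ψ ∘ₗ φ) = reduction deg' deg'' a ψ ∘ₗ reduction deg deg' a φ := by
  refine reduction_comp_of_forall a fun b c e hb hc he => ?_
  rcases h with h | h
  · rw [h.constantCoeff_eq_zero (b := b) (c := e) (fun h' => he (h' ▸ hb)), mul_zero]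
  · rw [h.constantCoeff_eq_zero (b := e) (c := c) (fun h' => he (h'.trans hc)), zero_mul]

theorem reduction_id [Fintype α] [DecidableEq α] (deg : α → V →₀ ℕ) (a : V →₀ ℕ) :
    reduction (k := k) deg deg a LinearMap.id = LinearMap.id := by
  classical
  refine (congrArg Matrix.mulVecLin (Matrix.ext fun b b' => ?_)).trans Matrix.mulVecLin_one
  rw [Matrix.of_apply, LinearMap.id_apply, Matrix.one_apply]
  split_ifs with h
  · simp [h]
  · rw [Pi.single_eq_of_ne (fun e => h (Subtype.ext e)), map_zero]

theorem reduction_add [Fintype α] [DecidableEq α] (deg : α → V →₀ ℕ) (deg' : β → V →₀ ℕ) (a : V →₀ ℕ)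
    (φ ψ : (α → MvPolynomial V k) →ₗ[MvPolynomial V k] (β → MvPolynomial V k)) :
    reduction deg deg' a (φ + ψ) = reduction deg deg' a φ + reduction deg deg' a ψ := by
  classical
  unfold reduction
  rw [← Matrix.mulVecLin_add]
  exact congrArg _ (Matrix.ext fun b b' => by simp)

theorem reduction_sub [Fintype α] [DecidableEq α] (deg : α → V →₀ ℕ) (deg' : β → V →₀ ℕ) (a : V →₀ ℕ)
    (φ ψ : (α → MvPolynomial V k) →ₗ[MvPolynomial V k] (β → MvPolynomial V k)) :
    reduction deg deg' a (φ - ψ) = reduction deg deg' a φ - reduction deg deg' a ψ := by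
  rw [eq_sub_iff_add_eq, ← reduction_add, sub_add_cancel]

end Reduction

/-! ### Comparison of resolutions: chain maps and homotopies -/

/-- A complex `⋯ → F₂ → F₁ → F₀` of finitely generated multigraded free modules over
`k[x_v | v ∈ V]` that is exact except at `F₀`. -/
structure AcyclicComplex (V k : Type*) [Field k] where
  /-- The bases. -/
  ι : ℕ → Type
  [fintype : ∀ i, Fintype (ι i)]
  [decEq : ∀ i, DecidableEq (ι i)]
  /-- The multidegrees of the basis elements. -/
  deg : ∀ i, ι i → V →₀ ℕ
  /-- The differentials. -/
  d : ∀ i, (ι (i + 1) → MvPolynomial V k) →ₗ[MvPolynomial V k] (ι i → MvPolynomial V k)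
  homog : ∀ i, IsHomogMap (deg (i + 1)) (deg i) (d i)
  exact_succ : ∀ i, Function.Exact (d (i + 1)) (d i)

attribute [instance] AcyclicComplex.fintype AcyclicComplex.decEq

namespace AcyclicComplex

variable {V k : Type*} [Field k]

theorem d_comp_d (F : AcyclicComplex V k) (i : ℕ) : F.d i ∘ₗ F.d (i + 1) = 0 :=
  (F.exact_succ i).linearMap_comp_eq_zero

theorem mem_range (F : AcyclicComplex V k) {i : ℕ} {x : F.ι (i + 1) → MvPolynomial V k}
    (h : F.d i x = 0) : x ∈ LinearMap.range (F.d (i + 1)) :=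
  (F.exact_succ i x).1 h

/-- A homogeneous map `F₀(-s) → G₀` that sends boundaries to boundaries extends to a homogeneous
chain map `F(-s) → G`. -/
theorem exists_chainMap (F G : AcyclicComplex V k) (s : V →₀ ℕ)
    (φ₀ : (F.ι 0 → MvPolynomial V k) →ₗ[MvPolynomial V k] (G.ι 0 → MvPolynomial V k))
    (h₀ : IsHomogMap (fun b => s + F.deg 0 b) (G.deg 0) φ₀)
    (hr : ∀ x, φ₀ (F.d 0 x) ∈ LinearMap.range (G.d 0)) :
    ∃ φ : ∀ i, (F.ι i → MvPolynomial V k) →ₗ[MvPolynomial V k] (G.ι i → MvPolynomial V k),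
      φ 0 = φ₀ ∧ (∀ i, IsHomogMap (fun b => s + F.deg i b) (G.deg i) (φ i)) ∧
      ∀ i, G.d i ∘ₗ φ (i + 1) = φ i ∘ₗ F.d i := by
  -- The recursion carries, with each map, that it sends boundaries to boundaries; this is exactly
  -- what permits the next lift.
  let S : ℕ → Type _ := fun i =>
    {φ : (F.ι i → MvPolynomial V k) →ₗ[MvPolynomial V k] (G.ι i → MvPolynomial V k) //
      IsHomogMap (fun b => s + F.deg i b) (G.deg i) φ ∧
        ∀ x, φ (F.d i x) ∈ LinearMap.range (G.d i)}
  have shift : ∀ i, IsHomogMap (fun b => s + F.deg (i + 1) b) (fun b => s + F.deg i b) (F.d i) :=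
    fun i b c m hm => by
      change m + (s + _) = s + _
      rw [← F.homog i b c m hm, add_left_comm]
  have step : ∀ i (φ : S i), ∃ ψ : S (i + 1), G.d i ∘ₗ ψ.1 = φ.1 ∘ₗ F.d i := by
    rintro i ⟨φ, hφ, hφr⟩
    obtain ⟨ψ, hψ, hψc⟩ := (G.homog i).exists_lift (hφ.comp (shift i)) hφr
    refine ⟨⟨ψ, hψ, fun x => G.mem_range ?_⟩, hψc⟩
    have h1 := LinearMap.congr_fun hψc (F.d (i + 1) x)
    have h2 := LinearMap.congr_fun (F.d_comp_d i) x
    simp only [LinearMap.comp_apply, LinearMap.zero_apply] at h1 h2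
    rw [h1, h2, map_zero]
  choose next hnext using step
  let seq : ∀ i, S i := fun i => Nat.rec ⟨φ₀, h₀, hr⟩ next i
  exact ⟨fun i => (seq i).1, rfl, fun i => (seq i).2.1, fun i => hnext i (seq i)⟩

/-- A chain map `F → F` whose component `F₀ → F₀` takes values in the boundaries is
null-homotopic. -/
theorem exists_homotopy (F : AcyclicComplex V k)
    (θ : ∀ i, (F.ι i → MvPolynomial V k) →ₗ[MvPolynomial V k] (F.ι i → MvPolynomial V k))
    (hθ : ∀ i, IsHomogMap (F.deg i) (F.deg i) (θ i))
    (hd : ∀ i, F.d i ∘ₗ θ (i + 1) = θ i ∘ₗ F.d i)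
    (h₀ : ∀ x, θ 0 x ∈ LinearMap.range (F.d 0)) :
    ∃ h : ∀ i, (F.ι i → MvPolynomial V k) →ₗ[MvPolynomial V k] (F.ι (i + 1) → MvPolynomial V k),
      θ 0 = F.d 0 ∘ₗ h 0 ∧ ∀ i, θ (i + 1) = F.d (i + 1) ∘ₗ h (i + 1) + h i ∘ₗ F.d i := by
  -- The invariant `d h d = θ d` is the homotopy identity composed with `d`, which removes the
  -- earlier homotopy. It makes `θ - h d` in the next step take values in cycles, hence in
  -- boundaries.
  let S : ℕ → Type _ := fun i =>
    {h : (F.ι i → MvPolynomial V k) →ₗ[MvPolynomial V k] (F.ι (i + 1) → MvPolynomial V k) //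
      IsHomogMap (F.deg i) (F.deg (i + 1)) h ∧ F.d i ∘ₗ h ∘ₗ F.d i = θ i ∘ₗ F.d i}
  obtain ⟨h0, h0h, h0c⟩ := (F.homog 0).exists_lift (hθ 0) h₀
  have step : ∀ i (h : S i), ∃ h' : S (i + 1), F.d (i + 1) ∘ₗ h'.1 = θ (i + 1) - h.1 ∘ₗ F.d i := by
    rintro i ⟨h, hh, hc⟩
    obtain ⟨g, hg, hgc⟩ := (F.homog (i + 1)).exists_lift ((hθ (i + 1)).sub (hh.comp (F.homog i)))
      (fun x => F.mem_range (by
        have h1 := LinearMap.congr_fun hc x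
        have h2 := LinearMap.congr_fun (hd i) x
        simp only [LinearMap.comp_apply] at h1 h2
        rw [LinearMap.sub_apply, map_sub, LinearMap.comp_apply, h1, h2, sub_self]))
    refine ⟨⟨g, hg, ?_⟩, hgc⟩
    rw [← LinearMap.comp_assoc, hgc, LinearMap.sub_comp, LinearMap.comp_assoc, F.d_comp_d,
      LinearMap.comp_zero, sub_zero]
  choose next hnext using step
  let seq : ∀ i, S i := fun i => Nat.rec ⟨h0, h0h, by rw [← LinearMap.comp_assoc, h0c]⟩ next i
  refine ⟨fun i => (seq i).1, h0c.symm, fun i => ?_⟩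
  rw [hnext i (seq i), sub_add_cancel]

end AcyclicComplex

/-- A multigraded free resolution `⋯ → F₁ → R → R/I` in which `F₀ = R` is generated in
multidegree `0`. -/
structure CyclicResolution {V k : Type*} [Field k] (I : Ideal (MvPolynomial V k)) extends
    AcyclicComplex V k where
  [unique : Unique (ι 0)]
  deg_zero : ∀ b, deg 0 b = 0
  mem_range_zero : ∀ f : ι 0 → MvPolynomial V k, f ∈ LinearMap.range (d 0) ↔ f default ∈ I

attribute [instance] CyclicResolution.unique

namespace MultigradedFreeResolution

variable {V k : Type*} [Field k] {I : Ideal (MvPolynomial V k)}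

/-- The complex of free modules that underlies a resolution. -/
abbrev toAcyclicComplex (F : MultigradedFreeResolution I) : AcyclicComplex V k where
  ι i := Fin (F.rank i)
  deg := F.deg
  d := F.d
  homog := F.d_homogeneous
  exact_succ := F.exact_succ

theorem mk_eq_aug_of_basis (F : MultigradedFreeResolution I)
    (φ : (Fin (F.rank 0) → MvPolynomial V k) →ₗ[MvPolynomial V k] MvPolynomial V k)
    (hφ : ∀ b, Ideal.Quotient.mk I (φ (Pi.single b 1)) = F.aug (Pi.single b 1))
    (x : Fin (F.rank 0) → MvPolynomial V k) : Ideal.Quotient.mk I (φ x) = F.aug x := by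
  have : (Ideal.Quotient.mkₐ (MvPolynomial V k) I).toLinearMap ∘ₗ φ = F.aug :=
    LinearMap.pi_ext' fun b => LinearMap.ext_ring (hφ b)
  exact LinearMap.congr_fun this x

/-- The reduction of a resolution of `R/I` is, up to homotopy, that of any other one. -/
theorem exists_homotopyEquiv (F : MultigradedFreeResolution I) (G : CyclicResolution I) :
    ∃ (φ : ∀ i, (Fin (F.rank i) → MvPolynomial V k) →ₗ[MvPolynomial V k]
          (G.ι i → MvPolynomial V k))
      (ψ : ∀ i, (G.ι i → MvPolynomial V k) →ₗ[MvPolynomial V k]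
          (Fin (F.rank i) → MvPolynomial V k)),
      (∀ i, IsHomogMap (F.deg i) (G.deg i) (φ i)) ∧
      (∀ i, IsHomogMap (G.deg i) (F.deg i) (ψ i)) ∧
      (∀ i, G.d i ∘ₗ φ (i + 1) = φ i ∘ₗ F.d i) ∧
      (∀ i, F.d i ∘ₗ ψ (i + 1) = ψ i ∘ₗ G.d i) ∧
      (∃ h : ∀ i, (Fin (F.rank i) → MvPolynomial V k) →ₗ[MvPolynomial V k]
          (Fin (F.rank (i + 1)) → MvPolynomial V k),
        ψ 0 ∘ₗ φ 0 - LinearMap.id = F.d 0 ∘ₗ h 0 ∧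
        ∀ i, ψ (i + 1) ∘ₗ φ (i + 1) - LinearMap.id =
          F.d (i + 1) ∘ₗ h (i + 1) + h i ∘ₗ F.d i) ∧
      (∃ h : ∀ i, (G.ι i → MvPolynomial V k) →ₗ[MvPolynomial V k]
          (G.ι (i + 1) → MvPolynomial V k),
        φ 0 ∘ₗ ψ 0 - LinearMap.id = G.d 0 ∘ₗ h 0 ∧
        ∀ i, φ (i + 1) ∘ₗ ψ (i + 1) - LinearMap.id =
          G.d (i + 1) ∘ₗ h (i + 1) + h i ∘ₗ G.d i) := by
  -- the map `F₀ → G₀`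
  choose a ha using F.aug_homogeneous
  let φ₀ : (Fin (F.rank 0) → MvPolynomial V k) →ₗ[MvPolynomial V k] (G.ι 0 → MvPolynomial V k) :=
    Fintype.linearCombination (MvPolynomial V k) fun b _ => monomial (F.deg 0 b) (a b)
  have hφ₀s : ∀ b, φ₀ (Pi.single b 1) = fun _ => monomial (F.deg 0 b) (a b) := fun b => by
    rw [Fintype.linearCombination_apply_single, one_smul]
  have hφ₀h : IsHomogMap (F.deg 0) (G.deg 0) φ₀ := fun b c m hm => by
    rw [hφ₀s] at hm
    rw [G.deg_zero, add_zero]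
    exact Finset.mem_singleton.1 (support_monomial_subset hm)
  have hφ₀ : ∀ x, Ideal.Quotient.mk I (φ₀ x default) = F.aug x :=
    F.mk_eq_aug_of_basis (LinearMap.proj default ∘ₗ φ₀) fun b => by
      rw [LinearMap.comp_apply, hφ₀s, ha]; rfl
  have hG : ∀ f, f ∈ LinearMap.range (G.d 0) ↔ Ideal.Quotient.mk I (f default) = 0 := fun f => by
    rw [G.mem_range_zero, Ideal.Quotient.eq_zero_iff_mem]
  have hF : ∀ f, f ∈ LinearMap.range (F.d 0) ↔ F.aug f = 0 := fun f => (F.exact_zero f).symm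
  -- the map `G₀ → F₀`
  obtain ⟨p, hp⟩ := F.aug_surjective 1
  -- The augmentation is not known to respect components, so the claim is transported by `φ₀`: `φ₀ p
  -- - 1` is a boundary of `G`, its component of degree `0` is again a boundary, and `1` is its own
  -- component because `G.deg 0` vanishes.
  have hp' : F.aug (homogComponent (F.deg 0) 0 p) = 1 := by
    have h1 : φ₀ p - Pi.single default 1 ∈ LinearMap.range (G.d 0) := by
      rw [hG, Pi.sub_apply, map_sub, hφ₀, hp, Pi.single_eq_same, map_one, sub_self]
    obtain ⟨q, hq⟩ := h1
    have h2 : φ₀ (homogComponent (F.deg 0) 0 p) - Pi.single default 1 ∈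
        LinearMap.range (G.d 0) := by
      refine ⟨homogComponent (G.deg 1) 0 q, ?_⟩
      rw [(G.homog 0).map_homogComponent, hq, map_sub, hφ₀h.map_homogComponent]
      congr 1
      have := isHomogVec_basis (k := k) (G.deg 0) default
      rw [G.deg_zero, isHomogVec_iff] at this
      exact this
    rw [hG, Pi.sub_apply, map_sub, hφ₀, Pi.single_eq_same, map_one, sub_eq_zero] at h2
    exact h2
  let ψ₀ : (G.ι 0 → MvPolynomial V k) →ₗ[MvPolynomial V k] (Fin (F.rank 0) → MvPolynomial V k) :=
    Fintype.linearCombination (MvPolynomial V k) fun _ => homogComponent (F.deg 0) 0 p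
  have hψ₀h : IsHomogMap (G.deg 0) (F.deg 0) ψ₀ := fun b => by
    rw [G.deg_zero, Fintype.linearCombination_apply_single, one_smul]
    exact isHomogVec_homogComponent _ _ _
  have hψ₀ : ∀ x, F.aug (ψ₀ x) = Ideal.Quotient.mk I (x default) := by
    intro x
    rw [Fintype.linearCombination_apply, Fintype.sum_unique, map_smul, hp']
    exact congrArg (Ideal.Quotient.mk I) (mul_one _)
  obtain ⟨φ, hφ0, hφh, hφd⟩ := AcyclicComplex.exists_chainMap F.toAcyclicComplex G.toAcyclicComplex 0 φ₀
    (by simp only [zero_add]; exact hφ₀h)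
    (fun x => (hG _).2 ((hφ₀ _).trans ((hF _).1 ⟨x, rfl⟩)))
  obtain ⟨ψ, hψ0, hψh, hψd⟩ := AcyclicComplex.exists_chainMap G.toAcyclicComplex F.toAcyclicComplex 0 ψ₀
    (by simp only [zero_add]; exact hψ₀h)
    (fun x => (hF _).2 ((hψ₀ _).trans ((hG _).1 ⟨x, rfl⟩)))
  simp only [zero_add] at hφh hψh
  refine ⟨φ, ψ, hφh, hψh, hφd, hψd, ?_, ?_⟩
  · refine AcyclicComplex.exists_homotopy F.toAcyclicComplex
      (fun i => ψ i ∘ₗ φ i - LinearMap.id) (fun i => ((hψh i).comp (hφh i)).sub (.id _))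
      (fun i => ?_) (fun x => (hF _).2 ?_)
    · rw [LinearMap.comp_sub, LinearMap.sub_comp, ← LinearMap.comp_assoc, hψd,
        LinearMap.comp_assoc, hφd]
      rfl
    · simp only [hφ0, hψ0]
      change F.aug (ψ₀ (φ₀ x) - x) = 0
      rw [map_sub, hψ₀, hφ₀, sub_self]
  · refine AcyclicComplex.exists_homotopy G.toAcyclicComplex
      (fun i => φ i ∘ₗ ψ i - LinearMap.id) (fun i => ((hφh i).comp (hψh i)).sub (.id _))
      (fun i => ?_) (fun x => (hG _).2 ?_)
    · rw [LinearMap.comp_sub, LinearMap.sub_comp, ← LinearMap.comp_assoc, hφd,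
        LinearMap.comp_assoc, hψd]
      rfl
    · simp only [hφ0, hψ0]
      change Ideal.Quotient.mk I (φ₀ (ψ₀ x) default - x default) = 0
      rw [map_sub, hφ₀, hψ₀, sub_self]

end MultigradedFreeResolution

/-! ### Graded Tor from a minimal resolution -/

/-- Consecutive generators of a linear or, more generally, minimal resolution have different
multidegrees. -/
def CyclicResolution.HasDistinctDegrees {V k : Type*} [Field k] {I : Ideal (MvPolynomial V k)}
    (G : CyclicResolution I) : Prop :=
  ∀ i (b : G.ι (i + 1)) (c : G.ι i), G.deg (i + 1) b ≠ G.deg i c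

/-- An entry of this block would need generators of degree `a` in two consecutive steps. -/
theorem CyclicResolution.HasDistinctDegrees.reduction_eq_zero {V k : Type*} [Field k]
    {I : Ideal (MvPolynomial V k)} {G : CyclicResolution I} (hG : G.HasDistinctDegrees) (i : ℕ)
    (a : V →₀ ℕ) : reduction (G.deg (i + 1)) (G.deg i) a (G.d i) = 0 := by
  classical
  refine (congrArg Matrix.mulVecLin (Matrix.ext fun b c => ?_)).trans Matrix.mulVecLin_zero
  exact absurd (c.2.trans b.2.symm) (hG i c.1 b.1)

/-- The dimension of the homology of a complex is that of the space `W` if the complex is homotopy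
equivalent to a complex with zero differentials and `W` at this place. -/
theorem finrank_quotient_submoduleOf_eq {k U W : Type*} [Field k] [AddCommGroup U] [Module k U]
    [AddCommGroup W] [Module k W] (Z B : Submodule k U) (Φ : U →ₗ[k] W) (Ψ : W →ₗ[k] U)
    (hΨ : ∀ w, Ψ w ∈ Z) (hΦΨ : ∀ w, Φ (Ψ w) = w) (hB : ∀ u ∈ B, Φ u = 0)
    (hZ : ∀ u ∈ Z, Ψ (Φ u) - u ∈ B) :
    Module.finrank k (Z ⧸ B.submoduleOf Z) = Module.finrank k W := by
  have hk : LinearMap.ker (Φ ∘ₗ Z.subtype) = B.submoduleOf Z := by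
    ext u
    change Φ u = 0 ↔ (u : U) ∈ B
    refine ⟨fun h => ?_, hB _⟩
    have := hZ u u.2
    rw [h, map_zero, zero_sub] at this
    exact B.neg_mem_iff.1 this
  rw [← hk]
  exact ((Φ ∘ₗ Z.subtype).quotKerEquivOfSurjective
    fun w => ⟨⟨Ψ w, hΨ w⟩, hΦΨ w⟩).finrank_eq

/-- `dim Tor_i(R/I, k)_a` is the number of generators of multidegree `a` in step `i` of a minimal
resolution. -/
theorem MultigradedFreeResolution.finrank_gradedTor {V k : Type*} [Field k]
    {I : Ideal (MvPolynomial V k)} (F : MultigradedFreeResolution I) {G : CyclicResolution I}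
    (hG : G.HasDistinctDegrees) (i : ℕ) (a : V →₀ ℕ) :
    Module.finrank k (F.gradedTor a i) = Nat.card {b : G.ι i // G.deg i b = a} := by
  classical
  obtain ⟨φ, ψ, hφ, hψ, hφd, hψd, ⟨h, h0, hs⟩, ⟨h', h0', hs'⟩⟩ := F.exists_homotopyEquiv G
  have hD : ∀ i, F.tensorD a i = reduction (F.deg (i + 1)) (F.deg i) a (F.d i) := fun i => rfl
  have hFh : ∀ i, IsHomogMap (F.deg (i + 1)) (F.deg i) (F.d i) := F.d_homogeneous
  have key : Module.finrank k (F.gradedTor a i) =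
      Module.finrank k ({b : G.ι i // G.deg i b = a} → k) := by
    have hred1 : ∀ i, reduction (G.deg i) (F.deg i) a (ψ i) ∘ₗ
        reduction (F.deg i) (G.deg i) a (φ i) - LinearMap.id =
        reduction (F.deg i) (F.deg i) a (ψ i ∘ₗ φ i - LinearMap.id) := fun i => by
      rw [reduction_sub, reduction_id, IsHomogMap.reduction_comp a (.inl (hφ i))]
    have hred2 : ∀ i, reduction (F.deg i) (G.deg i) a (φ i) ∘ₗ
        reduction (G.deg i) (F.deg i) a (ψ i) - LinearMap.id =
        reduction (G.deg i) (G.deg i) a (φ i ∘ₗ ψ i - LinearMap.id) := fun i => by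
      rw [reduction_sub, reduction_id, IsHomogMap.reduction_comp a (.inl (hψ i))]
    -- The differentials of `G` reduce to zero. Hence `ψ` lands in cycles, `φ` kills boundaries, and
    -- `φ ψ` reduces to the identity itself since both homotopy terms vanish. On the side of `F` the
    -- term `h d` vanishes on cycles, and `d h` is a boundary.
    refine finrank_quotient_submoduleOf_eq _ _ (reduction (F.deg i) (G.deg i) a (φ i))
      (reduction (G.deg i) (F.deg i) a (ψ i)) ?_ ?_ ?_ ?_
    · intro w
      cases i with
      | zero => trivial
      | succ i =>
        change F.tensorD a i _ = 0
        have := IsHomogMap.reduction_comp a (.inr (hFh i)) (φ := ψ (i + 1)) (deg := G.deg (i + 1))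
        rw [hψd, IsHomogMap.reduction_comp a (.inl (G.homog i)) (deg' := G.deg i),
          hG.reduction_eq_zero, LinearMap.comp_zero] at this
        exact (LinearMap.congr_fun this w).symm
    · intro w
      have : reduction (G.deg i) (G.deg i) a (φ i ∘ₗ ψ i - LinearMap.id) = 0 := by
        cases i with
        | zero =>
          rw [h0', IsHomogMap.reduction_comp a (.inr (G.homog 0)), hG.reduction_eq_zero,
            LinearMap.zero_comp]
        | succ i =>
          rw [hs', reduction_add, IsHomogMap.reduction_comp a (.inr (G.homog (i + 1))),
            IsHomogMap.reduction_comp a (.inl (G.homog i)) (deg' := G.deg i),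
            hG.reduction_eq_zero, hG.reduction_eq_zero,
            LinearMap.zero_comp, LinearMap.comp_zero, add_zero]
      rw [← hred2, sub_eq_zero] at this
      exact LinearMap.congr_fun this w
    · rintro _ ⟨u, rfl⟩
      have := IsHomogMap.reduction_comp a (.inr (G.homog i)) (φ := φ (i + 1)) (deg := F.deg (i + 1))
      rw [hφd, IsHomogMap.reduction_comp a (.inl (hFh i)), hG.reduction_eq_zero,
        LinearMap.zero_comp] at this
      exact LinearMap.congr_fun this u
    · intro u hu
      have := LinearMap.congr_fun (hred1 i) u
      rw [LinearMap.sub_apply, LinearMap.comp_apply, LinearMap.id_apply] at this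
      rw [this]
      cases i with
      | zero =>
        rw [h0, IsHomogMap.reduction_comp a (.inr (hFh 0)) (deg' := F.deg 1)]
        exact ⟨_, rfl⟩
      | succ i =>
        have hu' : reduction (F.deg (i + 1)) (F.deg i) a (F.d i) u = 0 := hu
        rw [hs, reduction_add, IsHomogMap.reduction_comp a (.inr (hFh (i + 1)))
            (deg' := F.deg (i + 2)),
          IsHomogMap.reduction_comp a (.inl (hFh i)) (deg' := F.deg i), LinearMap.add_apply,
          LinearMap.comp_apply (reduction _ _ _ (h i)), hu', map_zero, add_zero]
        exact ⟨_, rfl⟩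
  rw [key, Module.finrank_fintype_fun_eq_card, Nat.card_eq_fintype_card]

/-! ### Mapping cones and Koszul resolutions -/

section MappingCone

variable {V k : Type*} [Field k]

/-- The map `A ⊕ B → A' ⊕ B'` with the components `f : A → A'`, `g : B → A'` and `-h : B → B'`. -/
def coneMap {R α β α' β' : Type*} [CommRing R] (f : (α → R) →ₗ[R] (α' → R))
    (g : (β → R) →ₗ[R] (α' → R)) (h : (β → R) →ₗ[R] (β' → R)) :
    (α ⊕ β → R) →ₗ[R] (α' ⊕ β' → R) where
  toFun x := Sum.elim (f (x ∘ Sum.inl) + g (x ∘ Sum.inr)) (-h (x ∘ Sum.inr))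
  map_add' x y := by
    have h1 : (x + y) ∘ Sum.inl = x ∘ Sum.inl + y ∘ Sum.inl := rfl
    have h2 : (x + y) ∘ Sum.inr = x ∘ Sum.inr + y ∘ Sum.inr := rfl
    rw [h1, h2]
    ext (a | b)
    · simp only [map_add, Sum.elim_inl, Pi.add_apply]; ring
    · simp only [map_add, Sum.elim_inr, Pi.add_apply, Pi.neg_apply]; ring
  map_smul' r x := by
    have h1 : (r • x) ∘ Sum.inl = r • x ∘ Sum.inl := rfl
    have h2 : (r • x) ∘ Sum.inr = r • x ∘ Sum.inr := rfl
    rw [h1, h2]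
    ext (a | b)
    · simp [mul_add]
    · simp

theorem single_inl_comp_inl {R α β : Type*} [Zero R] [DecidableEq α] [DecidableEq β] (a : α)
    (r : R) : (Pi.single (Sum.inl a) r : α ⊕ β → R) ∘ Sum.inl = Pi.single a r := by
  ext a'
  by_cases h : a' = a
  · subst h; simp
  · simp [h]

theorem single_inl_comp_inr {R α β : Type*} [Zero R] [DecidableEq α] [DecidableEq β] (a : α)
    (r : R) : (Pi.single (Sum.inl a) r : α ⊕ β → R) ∘ Sum.inr = 0 := by
  ext b
  simp

theorem single_inr_comp_inl {R α β : Type*} [Zero R] [DecidableEq α] [DecidableEq β] (b : β)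
    (r : R) : (Pi.single (Sum.inr b) r : α ⊕ β → R) ∘ Sum.inl = 0 := by
  ext b
  simp

theorem single_inr_comp_inr {R α β : Type*} [Zero R] [DecidableEq α] [DecidableEq β] (b : β)
    (r : R) : (Pi.single (Sum.inr b) r : α ⊕ β → R) ∘ Sum.inr = Pi.single b r := by
  ext b'
  by_cases h : b' = b
  · subst h; simp
  · simp [h]

namespace AcyclicComplex

variable (F K : AcyclicComplex V k)

/-- The bases of the mapping cone. -/
@[reducible] def coneIndex : ℕ → Type
  | 0 => F.ι 0
  | i + 1 => F.ι (i + 1) ⊕ K.ι i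

/-- The multidegrees of the bases of the mapping cone of a map `K(-m) → F`. -/
def coneDeg (m : V →₀ ℕ) : ∀ i, coneIndex F K i → V →₀ ℕ
  | 0 => F.deg 0
  | i + 1 => Sum.elim (F.deg (i + 1)) fun b => m + K.deg i b

variable (χ : ∀ i, (K.ι i → MvPolynomial V k) →ₗ[MvPolynomial V k] (F.ι i → MvPolynomial V k))

/-- The differentials of the mapping cone. -/
def coneD : ∀ i, (coneIndex F K (i + 1) → MvPolynomial V k) →ₗ[MvPolynomial V k]
    (coneIndex F K i → MvPolynomial V k)
  | 0 => F.d 0 ∘ₗ LinearMap.funLeft _ _ Sum.inl + χ 0 ∘ₗ LinearMap.funLeft _ _ Sum.inr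
  | i + 1 => coneMap (F.d (i + 1)) (χ (i + 1)) (K.d i)

theorem coneD_zero_apply (x : F.ι 1 ⊕ K.ι 0 → MvPolynomial V k) :
    coneD F K χ 0 x = F.d 0 (x ∘ Sum.inl) + χ 0 (x ∘ Sum.inr) := rfl

theorem coneD_succ_apply (i : ℕ) (x : F.ι (i + 2) ⊕ K.ι (i + 1) → MvPolynomial V k) :
    coneD F K χ (i + 1) x =
      Sum.elim (F.d (i + 1) (x ∘ Sum.inl) + χ (i + 1) (x ∘ Sum.inr)) (-K.d i (x ∘ Sum.inr)) := rfl

instance coneIndex.fintype : ∀ i, Fintype (coneIndex F K i)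
  | 0 => F.fintype 0
  | _ + 1 => instFintypeSum _ _

instance coneIndex.decEq : ∀ i, DecidableEq (coneIndex F K i)
  | 0 => F.decEq 0
  | _ + 1 => instDecidableEqSum

theorem coneD_isHomogMap (m : V →₀ ℕ)
    (hχ : ∀ i, IsHomogMap (fun b => m + K.deg i b) (F.deg i) (χ i)) (i : ℕ) :
    IsHomogMap (coneDeg F K m (i + 1)) (coneDeg F K m i) (coneD F K χ i) := by
  cases i with
  | zero =>
    rintro (b | b)
    · change IsHomogVec (F.deg 0) (F.deg 1 b) (coneD F K χ 0 (Pi.single (Sum.inl b) 1))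
      rw [coneD_zero_apply, single_inl_comp_inl, single_inl_comp_inr, map_zero, add_zero]
      exact F.homog 0 b
    · change IsHomogVec (F.deg 0) (m + K.deg 0 b) (coneD F K χ 0 (Pi.single (Sum.inr b) 1))
      rw [coneD_zero_apply, single_inr_comp_inl, single_inr_comp_inr, map_zero, zero_add]
      exact hχ 0 b
  | succ i =>
    rintro (b | b)
    · change IsHomogVec _ (F.deg (i + 2) b) (coneD F K χ (i + 1) (Pi.single (Sum.inl b) 1))
      rw [coneD_succ_apply, single_inl_comp_inl, single_inl_comp_inr, map_zero, map_zero, add_zero]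
      rintro (c | c) n hn
      · exact F.homog (i + 1) b c n hn
      · simp at hn
    · change IsHomogVec _ (m + K.deg (i + 1) b) (coneD F K χ (i + 1) (Pi.single (Sum.inr b) 1))
      rw [coneD_succ_apply, single_inr_comp_inl, single_inr_comp_inr, map_zero, zero_add]
      rintro (c | c) n hn
      · exact hχ (i + 1) b c n hn
      · change n + (m + K.deg i c) = m + K.deg (i + 1) b
        rw [← K.homog i b c n (by simpa using hn), add_left_comm]

/-- The `K`-component of a cycle must be a boundary. Above the bottom this is exactness of `K`; at
the bottom it is `h₀`, the injectivity of the map that `χ 0` induces on the cokernels of `K.d 0` and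
`F.d 0`. -/
theorem coneD_exact_succ (hχ : ∀ i, F.d i ∘ₗ χ (i + 1) = χ i ∘ₗ K.d i)
    (h₀ : ∀ x, χ 0 x ∈ LinearMap.range (F.d 0) → x ∈ LinearMap.range (K.d 0)) (i : ℕ) :
    Function.Exact (coneD F K χ (i + 1)) (coneD F K χ i) := by
  have hχ' : ∀ i x, F.d i (χ (i + 1) x) = χ i (K.d i x) := fun i x =>
    LinearMap.congr_fun (hχ i) x
  have hF : ∀ i x, F.d i (F.d (i + 1) x) = 0 := fun i x => LinearMap.congr_fun (F.d_comp_d i) x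
  have hK : ∀ i x, K.d i (K.d (i + 1) x) = 0 := fun i x => LinearMap.congr_fun (K.d_comp_d i) x
  -- if the `K`-component of a cycle is a boundary, the cycle is a boundary
  have key : ∀ i (x : F.ι (i + 1) ⊕ K.ι i → MvPolynomial V k) (z : K.ι (i + 1) → MvPolynomial V k),
      K.d i z = x ∘ Sum.inr → F.d i (x ∘ Sum.inl) + χ i (x ∘ Sum.inr) = 0 →
      ∃ y, coneD F K χ (i + 1) y = x := by
    intro i x z hz hx
    rw [← hz, ← hχ', ← map_add] at hx
    obtain ⟨w, hw⟩ := F.mem_range hx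
    -- The sign compensates the `-h` in `coneMap`.
    refine ⟨Sum.elim w (-z), ?_⟩
    rw [coneD_succ_apply, Sum.elim_comp_inl, Sum.elim_comp_inr, hw, map_neg, map_neg, neg_neg, hz,
      add_neg_cancel_right]
    exact Sum.elim_comp_inl_inr x
  cases i with
  | zero =>
    intro x
    refine ⟨fun hx => ?_, ?_⟩
    · change F.ι 1 ⊕ K.ι 0 → MvPolynomial V k at x
      rw [coneD_zero_apply] at hx
      obtain ⟨z, hz⟩ := h₀ (x ∘ Sum.inr) ⟨-(x ∘ Sum.inl), by
        rw [map_neg]; exact neg_eq_of_add_eq_zero_right hx⟩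
      exact key 0 x z hz hx
    · rintro ⟨y, rfl⟩
      change F.ι 2 ⊕ K.ι 1 → MvPolynomial V k at y
      rw [coneD_succ_apply, coneD_zero_apply, Sum.elim_comp_inl, Sum.elim_comp_inr, map_add, hF,
        hχ', map_neg, zero_add, add_neg_cancel]
  | succ i =>
    intro x
    refine ⟨fun hx => ?_, ?_⟩
    · change F.ι (i + 2) ⊕ K.ι (i + 1) → MvPolynomial V k at x
      rw [coneD_succ_apply] at hx
      have h1 : F.d (i + 1) (x ∘ Sum.inl) + χ (i + 1) (x ∘ Sum.inr) = 0 :=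
        funext fun b => congrFun hx (Sum.inl b)
      have h2 : K.d i (x ∘ Sum.inr) = 0 :=
        funext fun b => neg_eq_zero.1 (congrFun hx (Sum.inr b))
      obtain ⟨z, hz⟩ := K.mem_range h2
      exact key (i + 1) x z hz h1
    · rintro ⟨y, rfl⟩
      change F.ι (i + 3) ⊕ K.ι (i + 2) → MvPolynomial V k at y
      rw [coneD_succ_apply, coneD_succ_apply, Sum.elim_comp_inl, Sum.elim_comp_inr, map_add, hF,
        hχ', map_neg, map_neg, hK, zero_add, add_neg_cancel, neg_zero, neg_zero]
      exact Sum.elim_zero_zero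

end AcyclicComplex

open AcyclicComplex in
/-- The mapping cone of a lift of the multiplication by a monomial `x^m` from `R/(J : x^m)` to
`R/J` is a resolution of `R/(J + (x^m))`. -/
theorem CyclicResolution.exists_mappingCone {I J J' : Ideal (MvPolynomial V k)}
    (F : CyclicResolution J) (K : CyclicResolution J') (m : V →₀ ℕ)
    (hJ : ∀ f, f * monomial m 1 ∈ J ↔ f ∈ J') (hI : J ⊔ Ideal.span {monomial m 1} = I) :
    ∃ C : CyclicResolution I,
      (∀ i, Fintype.card (C.ι (i + 1)) = Fintype.card (F.ι (i + 1)) + Fintype.card (K.ι i)) ∧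
      ∀ i b, (∃ c, C.deg (i + 1) b = F.deg (i + 1) c) ∨ ∃ c, C.deg (i + 1) b = m + K.deg i c := by
  subst hI
  let χ₀ : (K.ι 0 → MvPolynomial V k) →ₗ[MvPolynomial V k] (F.ι 0 → MvPolynomial V k) :=
    LinearMap.pi fun _ => LinearMap.mulRight _ (monomial m 1) ∘ₗ LinearMap.proj default
  have hχ₀ : ∀ x b, χ₀ x b = x default * monomial m 1 := fun x b => rfl
  have hχ₀h : IsHomogMap (fun b => m + K.deg 0 b) (F.deg 0) χ₀ := by
    intro b c n hn
    rw [Unique.eq_default b, hχ₀, Pi.single_eq_same, one_mul] at hn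
    rw [F.deg_zero, add_zero]
    change n = m + K.deg 0 b
    rw [K.deg_zero, add_zero]
    exact Finset.mem_singleton.1 (support_monomial_subset hn)
  -- The colon condition serves twice: from right to left, multiplication by `x^m` lifts to a chain
  -- map; from left to right, it is injective on cokernels, as exactness of the cone requires.
  have hrange : ∀ x, χ₀ x ∈ LinearMap.range (F.d 0) ↔ x ∈ LinearMap.range (K.d 0) := fun x => by
    rw [F.mem_range_zero, hχ₀, hJ, K.mem_range_zero]
  obtain ⟨χ, hχ0, hχh, hχd⟩ := exists_chainMap K.toAcyclicComplex F.toAcyclicComplex m χ₀ hχ₀h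
    fun x => (hrange _).2 ⟨x, rfl⟩
  refine ⟨{
    ι := coneIndex F.toAcyclicComplex K.toAcyclicComplex
    deg := coneDeg _ _ m
    d := coneD _ _ χ
    homog := coneD_isHomogMap _ _ _ _ hχh
    exact_succ := coneD_exact_succ _ _ _ hχd fun x => by rw [hχ0]; exact (hrange x).1
    unique := F.unique
    deg_zero := F.deg_zero
    mem_range_zero := ?_ }, fun i => Fintype.card_sum, ?_⟩
  · intro f
    rw [Submodule.mem_sup]
    constructor
    · rintro ⟨x, rfl⟩
      change F.ι 1 ⊕ K.ι 0 → MvPolynomial V k at x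
      refine ⟨F.d 0 (x ∘ Sum.inl) default, (F.mem_range_zero _).1 ⟨_, rfl⟩,
        χ 0 (x ∘ Sum.inr) default, ?_, rfl⟩
      rw [hχ0, hχ₀]
      exact Ideal.mul_mem_left _ _ (Ideal.mem_span_singleton_self _)
    · rintro ⟨y, hy, z, hz, hyz⟩
      obtain ⟨w, rfl⟩ := Ideal.mem_span_singleton'.1 hz
      obtain ⟨u, hu⟩ := (F.mem_range_zero fun _ => y).2 hy
      refine ⟨(Sum.elim u fun _ => w : F.ι 1 ⊕ K.ι 0 → MvPolynomial V k), ?_⟩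
      rw [coneD_zero_apply, Sum.elim_comp_inl, Sum.elim_comp_inr, hu, hχ0]
      funext b
      change F.ι 0 at b
      rw [Pi.add_apply, hχ₀, hyz]
      exact congrArg f (Subsingleton.elim (α := F.ι 0) _ _)
  · rintro i (b | b)
    · exact Or.inl ⟨b, rfl⟩
    · exact Or.inr ⟨b, rfl⟩

/-- The resolution `⋯ → 0 → R` of `R/0`. -/
def CyclicResolution.bot (V k : Type*) [Field k] :
    CyclicResolution (⊥ : Ideal (MvPolynomial V k)) where
  -- Since `0 ^ 0 = 1`, the rank is `1` in step `0` and `0` elsewhere.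
  ι i := Fin (0 ^ i)
  deg _ _ := 0
  d _ := 0
  homog i b c m hm := by simp at hm
  exact_succ i x := by
    have : IsEmpty (Fin (0 ^ (i + 1))) := by
      rw [pow_succ, mul_zero]; infer_instance
    exact ⟨fun _ => ⟨0, Subsingleton.elim _ _⟩, fun _ => rfl⟩
  unique := inferInstanceAs (Unique (Fin 1))
  deg_zero _ := rfl
  mem_range_zero f := by
    rw [LinearMap.range_zero, Submodule.mem_bot, Ideal.mem_bot]
    refine ⟨fun h => congrFun h _, fun h => funext fun b => ?_⟩
    rw [← Subsingleton.elim (α := Fin 1) default b]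
    exact h

/-- The generators of `I` have degree `q`, and the resolution is linear. -/
def CyclicResolution.IsLinear {I : Ideal (MvPolynomial V k)} (G : CyclicResolution I) (q : ℕ) :
    Prop :=
  ∀ i b, (G.deg (i + 1) b).degree = i + q

theorem CyclicResolution.card_zero {I : Ideal (MvPolynomial V k)} (G : CyclicResolution I) :
    Fintype.card (G.ι 0) = 1 :=
  Fintype.card_unique

/-- Total degrees strictly increase from step to step; `0 < q` is needed only between steps `0` and
`1`. -/
theorem CyclicResolution.IsLinear.hasDistinctDegrees {I : Ideal (MvPolynomial V k)}
    {G : CyclicResolution I} {q : ℕ} (hG : G.IsLinear q) (hq : 0 < q) : G.HasDistinctDegrees := by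
  intro i b c h
  have h1 := hG i b
  rw [h] at h1
  cases i with
  | zero =>
    rw [G.deg_zero, map_zero] at h1
    omega
  | succ i =>
    rw [hG i c] at h1
    omega

theorem CyclicResolution.IsLinear.degree_eq {I : Ideal (MvPolynomial V k)}
    {G : CyclicResolution I} (hG : G.IsLinear 1) (i : ℕ) (b : G.ι i) :
    (G.deg i b).degree = i := by
  cases i with
  | zero => rw [G.deg_zero, map_zero]
  | succ i => exact hG i b

theorem span_X_image_insert [DecidableEq V] (S : Finset V) (v : V) :
    Ideal.span (X '' (S : Set V) : Set (MvPolynomial V k)) ⊔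
      Ideal.span {monomial (Finsupp.single v 1) 1} =
    Ideal.span (X '' ((insert v S : Finset V) : Set V)) := by
  rw [Finset.coe_insert, Set.image_insert_eq, Set.insert_eq, Set.union_comm, Ideal.span_union]
  rfl

/-- The Koszul resolution of `R/⟨x_v | v ∈ S⟩`. -/
theorem exists_koszulResolution (S : Finset V) :
    ∃ K : CyclicResolution (Ideal.span (X '' (S : Set V) : Set (MvPolynomial V k))),
      (∀ i, Fintype.card (K.ι i) = S.card.choose i) ∧ K.IsLinear 1 := by
  classical
  induction S using Finset.induction_on with
  | empty =>
    rw [Finset.coe_empty, Set.image_empty, Ideal.span_empty]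
    refine ⟨.bot V k, fun i => ?_, fun i b => ?_⟩
    · change Fintype.card (Fin (0 ^ i)) = Nat.choose 0 i
      cases i <;> simp
    · change Fin (0 ^ (i + 1)) at b
      rw [pow_succ, mul_zero] at b
      exact b.elim0
  | insert v S hv ih =>
    obtain ⟨K, hKc, hKl⟩ := ih
    -- As `v ∉ S`, multiplication by `x_v` is injective modulo the variables of `S`, so the colon
    -- ideal is unchanged and the cone is of `K` over itself. The ranks then follow Pascal's rule.
    obtain ⟨C, hCc, hCd⟩ := K.exists_mappingCone K (Finsupp.single v 1) (fun f => by
      simp only [mem_ideal_span_X_image]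
      constructor
      · intro h m hm
        obtain ⟨w, hw, hw'⟩ := h (m + Finsupp.single v 1) (by
          rw [mem_support_iff, coeff_mul_monomial, mul_one]
          exact mem_support_iff.1 hm)
        refine ⟨w, hw, ?_⟩
        have : w ≠ v := fun e => hv (e ▸ hw)
        simpa [Finsupp.single_apply, this.symm] using hw'
      · intro h m hm
        rw [mem_support_iff, coeff_mul_monomial'] at hm
        split_ifs at hm with hle
        · obtain ⟨w, hw, hw'⟩ := h _ (mem_support_iff.2 (left_ne_zero_of_mul hm))
          refine ⟨w, hw, fun e => hw' ?_⟩
          simp [e]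
        · exact absurd rfl hm) (span_X_image_insert S v)
    refine ⟨C, fun i => ?_, fun i b => ?_⟩
    · cases i with
      | zero => rw [C.card_zero, Nat.choose_zero_right]
      | succ i => rw [hCc, hKc, hKc, Finset.card_insert_of_notMem hv, Nat.choose_succ_succ, add_comm]
    · rcases hCd i b with ⟨c, hc⟩ | ⟨c, hc⟩
      · rw [hc, hKl]
      · rw [hc, map_add, Finsupp.degree_single, hKl.degree_eq, add_comm]

end MappingCone

/-! ### Linear quotients for complete multipartite graphs -/

section Multipartite

variable {V T : Type*} [Fintype V] [DecidableEq T]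

/-- The sum over the sets `U` of `N` vertices of the number of classes that meet `U`, minus one. -/
def multipartiteCount (c : V → T) (N : ℕ) : ℕ :=
  ∑ U ∈ (Finset.univ : Finset V).powersetCard N, ((U.image c).card - 1)

variable [LinearOrder V] (c : V → T)

/-- The edges of a complete multipartite graph with colouring `c`, with ordered end points. -/
def orderedEdges : Finset (V ×ₗ V) :=
  {e | (ofLex e).1 < (ofLex e).2 ∧ c (ofLex e).1 ≠ c (ofLex e).2}

/-- The variables that generate the colon ideal of the edge `e` and the preceding edges. -/
def colonVars (e : V ×ₗ V) : Finset V :=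
  {w | w < (ofLex e).1 ∨ w < (ofLex e).2 ∧ c w ≠ c (ofLex e).1}

/-- The exponent of the monomial of an edge. -/
def edgeExponent (e : V ×ₗ V) : V →₀ ℕ :=
  Finsupp.single (ofLex e).1 1 + Finsupp.single (ofLex e).2 1

variable {c}

theorem mem_orderedEdges {e : V ×ₗ V} :
    e ∈ orderedEdges c ↔ (ofLex e).1 < (ofLex e).2 ∧ c (ofLex e).1 ≠ c (ofLex e).2 := by
  simp [orderedEdges]

theorem mem_colonVars {e : V ×ₗ V} {w : V} :
    w ∈ colonVars c e ↔ w < (ofLex e).1 ∨ w < (ofLex e).2 ∧ c w ≠ c (ofLex e).1 := by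
  simp [colonVars]

/-- The edge monomials have linear quotients. -/
theorem exists_edgeExponent_le_iff {a : V ×ₗ V} (ha : a ∈ orderedEdges c) (n : V →₀ ℕ) :
    (∃ e ∈ orderedEdges c, e < a ∧ edgeExponent e ≤ n + edgeExponent a) ↔
      ∃ w ∈ colonVars c a, n w ≠ 0 := by
  obtain ⟨⟨u, v⟩, rfl⟩ := toLex.surjective a
  obtain ⟨huv, hc⟩ := mem_orderedEdges.1 ha
  simp only [ofLex_toLex] at huv hc
  constructor
  · rintro ⟨e, he, hlt, hle⟩
    obtain ⟨⟨u', v'⟩, rfl⟩ := toLex.surjective e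
    obtain ⟨huv', hc'⟩ := mem_orderedEdges.1 he
    simp only [ofLex_toLex] at huv' hc'
    -- The first place where the smaller edge differs gives a vertex outside `{u, v}`, so its
    -- variable must divide `x^n`.
    rcases Prod.Lex.toLex_lt_toLex.1 hlt with h | ⟨h1, h2⟩
    · refine ⟨u', mem_colonVars.2 (Or.inl h), fun h0 => ?_⟩
      have := hle u'
      simp [edgeExponent, h0, h.ne', (h.trans huv).ne'] at this
    · simp only at h1 h2
      subst h1
      refine ⟨v', mem_colonVars.2 (Or.inr ⟨h2, hc'.symm⟩), fun h0 => ?_⟩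
      have := hle v'
      simp [edgeExponent, h0, huv'.ne, h2.ne'] at this
  · rintro ⟨w, hw, hn⟩
    have hwn : Finsupp.single w 1 ≤ n := by
      rw [Finsupp.single_le_iff]
      omega
    rcases mem_colonVars.1 hw with h | ⟨h1, h2⟩
    · simp only [ofLex_toLex] at h
      -- Since `c u ≠ c v`, the vertex `w` is adjacent to `u` or to `v`; either edge precedes `(u,
      -- v)` because it starts with `w < u`.
      by_cases hcw : c w = c v
      · refine ⟨toLex (w, u), mem_orderedEdges.2 ⟨h, fun e => hc (e.symm.trans hcw)⟩,
          Prod.Lex.toLex_lt_toLex.2 (Or.inl h), add_le_add hwn le_self_add⟩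
      · exact ⟨toLex (w, v), mem_orderedEdges.2 ⟨h.trans huv, hcw⟩,
          Prod.Lex.toLex_lt_toLex.2 (Or.inl h), add_le_add hwn le_add_self⟩
    · simp only [ofLex_toLex] at h1 h2
      rcases lt_trichotomy w u with h | h | h
      · by_cases hcw : c w = c v
        · refine ⟨toLex (w, u), mem_orderedEdges.2 ⟨h, fun e => hc (e.symm.trans hcw)⟩,
            Prod.Lex.toLex_lt_toLex.2 (Or.inl h), add_le_add hwn le_self_add⟩
        · exact ⟨toLex (w, v), mem_orderedEdges.2 ⟨h.trans huv, hcw⟩,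
            Prod.Lex.toLex_lt_toLex.2 (Or.inl h), add_le_add hwn le_add_self⟩
      · exact absurd (congrArg c h) h2
      · refine ⟨toLex (u, w), mem_orderedEdges.2 ⟨h, h2.symm⟩,
          Prod.Lex.toLex_lt_toLex.2 (Or.inr ⟨rfl, h1⟩), ?_⟩
        rw [edgeExponent, add_comm]
        exact add_le_add hwn le_self_add

/-- Membership in a monomial ideal is tested on the support, and multiplication by `x^m` translates
the support by `m`. So a colon ideal is determined by exponents alone. -/
theorem mul_monomial_mem_span_iff {V k : Type*} [Field k] {s : Set (V →₀ ℕ)} {S : Set V}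
    {m : V →₀ ℕ} (h : ∀ n, (∃ e ∈ s, e ≤ n + m) ↔ ∃ w ∈ S, n w ≠ 0) (f : MvPolynomial V k) :
    f * monomial m 1 ∈ Ideal.span ((fun e => monomial e (1 : k)) '' s) ↔
      f ∈ Ideal.span (X '' S : Set (MvPolynomial V k)) := by
  rw [mem_ideal_span_monomial_image, mem_ideal_span_X_image]
  constructor
  · intro H n hn
    refine (h n).1 (H (n + m) ?_)
    rw [mem_support_iff, coeff_mul_monomial, mul_one]
    exact mem_support_iff.1 hn
  · intro H n hn
    rw [mem_support_iff, coeff_mul_monomial'] at hn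
    split_ifs at hn with hle
    · have := (h (n - m)).2 (H _ (mem_support_iff.2 (left_ne_zero_of_mul hn)))
      rwa [tsub_add_cancel_of_le hle] at this
    · exact absurd rfl hn

/-- The linear resolution of the ideal generated by an initial segment of the edges. -/
theorem exists_resolution_of_isInitial (k : Type*) [Field k] (c : V → T) (s : Finset (V ×ₗ V)) :
    s ⊆ orderedEdges c → (∀ a ∈ s, ∀ e ∈ orderedEdges c, e ≤ a → e ∈ s) →
    ∃ G : CyclicResolution (Ideal.span ((fun e => monomial e (1 : k)) ''
        (edgeExponent '' (s : Set (V ×ₗ V))))),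
      (∀ i, Fintype.card (G.ι (i + 1)) = ∑ e ∈ s, (colonVars c e).card.choose i) ∧
      G.IsLinear 2 := by
  induction s using Finset.induction_on_max with
  | empty =>
    intro _ _
    rw [Finset.coe_empty, Set.image_empty, Set.image_empty, Ideal.span_empty]
    refine ⟨.bot V k, fun i => ?_, fun i b => ?_⟩
    · change Fintype.card (Fin (0 ^ (i + 1))) = 0
      simp
    · change Fin (0 ^ (i + 1)) at b
      rw [pow_succ, mul_zero] at b
      exact b.elim0
  | insert a s hlt ih =>
    intro hsub hinit
    have ha := hsub (Finset.mem_insert_self a s)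
    -- Initiality makes `s` all the edges before `a`, so the colon ideal by `a` is the one generated
    -- by `colonVars c a`.
    have hs : ∀ e, e ∈ s ↔ e ∈ orderedEdges c ∧ e < a := fun e =>
      ⟨fun h => ⟨hsub (Finset.mem_insert_of_mem h), hlt e h⟩, fun h =>
        (Finset.mem_insert.1 (hinit a (Finset.mem_insert_self a s) e h.1 h.2.le)).resolve_left
          h.2.ne⟩
    obtain ⟨F, hFc, hFl⟩ := ih ((Finset.subset_insert a s).trans hsub) fun b hb e he hle =>
      (hs e).2 ⟨he, hle.trans_lt (hlt b hb)⟩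
    obtain ⟨K, hKc, hKl⟩ := exists_koszulResolution (k := k) (colonVars c a)
    obtain ⟨C, hCc, hCd⟩ := F.exists_mappingCone K (edgeExponent a)
      (I := Ideal.span ((fun e => monomial e (1 : k)) ''
        (edgeExponent '' ((insert a s : Finset (V ×ₗ V)) : Set (V ×ₗ V)))))
      (mul_monomial_mem_span_iff fun n => by
        rw [← Finset.coe_image]
        simp only [Finset.mem_coe, Finset.mem_image, exists_exists_and_eq_and]
        rw [← exists_edgeExponent_le_iff ha]
        simp only [hs, and_assoc])
      (by
        rw [Finset.coe_insert, Set.image_insert_eq, Set.image_insert_eq, Set.insert_eq,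
          Ideal.span_union, sup_comm])
    refine ⟨C, fun i => ?_, fun i b => ?_⟩
    · rw [hCc, hFc, hKc, Finset.sum_insert (fun h => (hlt a h).ne rfl), add_comm]
    · rcases hCd i b with ⟨d, hd⟩ | ⟨d, hd⟩
      · rw [hd, hFl]
      · rw [hd, map_add, hKl.degree_eq, edgeExponent, map_add, Finsupp.degree_single,
          Finsupp.degree_single, add_comm]

theorem graphIdeal_eq_span_orderedEdges {k : Type*} [Field k] {Γ : SimpleGraph V}
    (hΓ : ∀ u v, Γ.Adj u v ↔ c u ≠ c v) :
    graphIdeal k Γ = Ideal.span ((fun e => monomial e (1 : k)) ''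
      (edgeExponent '' (orderedEdges c : Set (V ×ₗ V)))) := by
  have hX : ∀ u v : V, (X u * X v : MvPolynomial V k) = monomial (edgeExponent (toLex (u, v))) 1 :=
    fun u v => by simp [X, monomial_mul, edgeExponent]
  unfold graphIdeal
  congr 1
  ext p
  constructor
  · rintro ⟨u, v, h, rfl⟩
    have hc := (hΓ u v).1 h
    rcases lt_trichotomy u v with h' | h' | h'
    · exact ⟨_, ⟨toLex (u, v), mem_orderedEdges.2 ⟨h', hc⟩, rfl⟩, (hX u v).symm⟩
    · exact absurd (congrArg c h') hc
    · exact ⟨_, ⟨toLex (v, u), mem_orderedEdges.2 ⟨h', hc.symm⟩, rfl⟩,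
        ((mul_comm _ _).trans (hX v u)).symm⟩
  · rintro ⟨_, ⟨e, he, rfl⟩, rfl⟩
    exact ⟨_, _, (hΓ _ _).2 (mem_orderedEdges.1 (Finset.mem_coe.1 he)).2, (hX _ _).symm⟩

/-- The vertices of `U` that are maximal in their class, except the maximum of `U`. -/
def classMaxima (c : V → T) (U : Finset V) : Finset V :=
  {u ∈ U | (∃ v ∈ U, c v ≠ c u ∧ ∀ w ∈ U, w ≤ v) ∧ ∀ w ∈ U, c w = c u → w ≤ u}

/-- The colouring is injective on these maxima, and its values are the classes met by `U` other than
that of the maximum of `U`. -/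
theorem card_classMaxima (c : V → T) {U : Finset V} (hU : U.Nonempty) :
    (classMaxima c U).card = (U.image c).card - 1 := by
  have hM := U.max'_mem hU
  have hmax : ∀ v ∈ U, (∀ w ∈ U, w ≤ v) → v = U.max' hU := fun v hv h =>
    le_antisymm (U.le_max' v hv) (h _ hM)
  rw [← Finset.card_erase_of_mem (Finset.mem_image_of_mem c hM),
    ← Finset.card_image_of_injOn (f := c) (s := classMaxima c U)]
  · congr 1
    ext t
    simp only [classMaxima, Finset.mem_image, Finset.mem_filter, Finset.mem_erase]
    constructor
    · rintro ⟨u, ⟨hu, ⟨v, hv, hvc, hvm⟩, -⟩, rfl⟩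
      rw [hmax v hv hvm] at hvc
      exact ⟨hvc.symm, u, hu, rfl⟩
    · rintro ⟨hne, u, hu, rfl⟩
      have hne' : (U.filter fun w => c w = c u).Nonempty := ⟨u, Finset.mem_filter.2 ⟨hu, rfl⟩⟩
      obtain ⟨h1, h2⟩ := Finset.mem_filter.1 (Finset.max'_mem _ hne')
      refine ⟨_, ⟨h1, ⟨_, hM, ?_, fun w hw => U.le_max' w hw⟩, fun w hw hcw => ?_⟩, h2⟩
      · rw [h2]; exact hne.symm
      · exact Finset.le_max' _ _ (Finset.mem_filter.2 ⟨hw, hcw.trans h2⟩)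
  · intro u hu u' hu' h
    obtain ⟨hu, -, h1⟩ := Finset.mem_filter.1 (Finset.mem_coe.1 hu)
    obtain ⟨hu', -, h1'⟩ := Finset.mem_filter.1 (Finset.mem_coe.1 hu')
    exact le_antisymm (h1' u hu h) (h1 u' hu' h.symm)

/-- An edge `(u, v)` with an `i`-subset `S` of its colon variables corresponds to the pair of `U =
{u, v} ∪ S` and `u`. The condition on `S` says precisely that `v` is the maximum of `U` and `u` the
maximum of its class in `U`; thus `v` and `S` are recovered from `U` and `u`. -/
theorem sum_choose_card_colonVars (c : V → T) (i : ℕ) :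
    ∑ e ∈ orderedEdges c, (colonVars c e).card.choose i = multipartiteCount c (i + 2) := by
  have h1 : ∀ U ∈ (Finset.univ : Finset V).powersetCard (i + 2),
      (U.image c).card - 1 = (classMaxima c U).card := fun U hU => by
    refine (card_classMaxima c (Finset.card_pos.1 ?_)).symm
    rw [(Finset.mem_powersetCard.1 hU).2]
    omega
  rw [multipartiteCount, Finset.sum_congr rfl h1, ← Finset.card_sigma]
  simp only [← Finset.card_powersetCard]
  rw [← Finset.card_sigma]
  have hT : ∀ x ∈ (orderedEdges c).sigma fun e => (colonVars c e).powersetCard i,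
      (ofLex x.1).1 < (ofLex x.1).2 ∧ c (ofLex x.1).1 ≠ c (ofLex x.1).2 ∧ x.2.card = i ∧
      ∀ w ∈ x.2, w < (ofLex x.1).1 ∨ w < (ofLex x.1).2 ∧ c w ≠ c (ofLex x.1).1 := by
    intro x hx
    obtain ⟨hx1, hx2⟩ := Finset.mem_sigma.1 hx
    obtain ⟨hx3, hx4⟩ := Finset.mem_powersetCard.1 hx2
    exact ⟨(mem_orderedEdges.1 hx1).1, (mem_orderedEdges.1 hx1).2, hx4, fun w hw =>
      mem_colonVars.1 (hx3 hw)⟩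
  refine Finset.card_bij
    (fun x _ => ⟨insert (ofLex x.1).1 (insert (ofLex x.1).2 x.2), (ofLex x.1).1⟩) ?_ ?_ ?_
  · rintro ⟨e, S⟩ hx
    obtain ⟨⟨u, v⟩, rfl⟩ := toLex.surjective e
    obtain ⟨h1, h2, h3, h4⟩ := hT _ hx
    simp only [ofLex_toLex] at h1 h2 h3 h4 ⊢
    have hv : v ∉ S := fun h => by rcases h4 v h with h | h <;> order
    have hu : u ∉ S := fun h => by
      rcases h4 u h with h | h
      · order
      · exact h.2 rfl
    simp only [Finset.mem_sigma, Finset.mem_powersetCard, classMaxima, Finset.mem_filter,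
      Finset.subset_univ, true_and]
    refine ⟨?_, Finset.mem_insert_self _ _, ⟨v, by simp, h2.symm, ?_⟩, ?_⟩
    · rw [Finset.card_insert_of_notMem (by simp [h1.ne, hu]), Finset.card_insert_of_notMem hv, h3]
    · intro w hw
      simp only [Finset.mem_insert] at hw
      rcases hw with rfl | rfl | hw
      · exact h1.le
      · exact le_rfl
      · rcases h4 w hw with h | h
        · exact (h.trans h1).le
        · exact h.1.le
    · intro w hw hcw
      simp only [Finset.mem_insert] at hw
      rcases hw with rfl | rfl | hw
      · exact le_rfl
      · exact absurd hcw.symm h2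
      · rcases h4 w hw with h | h
        · exact h.le
        · exact absurd hcw h.2
  · rintro ⟨e, S⟩ hx ⟨e', S'⟩ hx' heq
    obtain ⟨⟨u, v⟩, rfl⟩ := toLex.surjective e
    obtain ⟨⟨u', v'⟩, rfl⟩ := toLex.surjective e'
    obtain ⟨h1, h2, -, h4⟩ := hT _ hx
    obtain ⟨h1', h2', -, h4'⟩ := hT _ hx'
    simp only [ofLex_toLex, Sigma.mk.injEq, heq_eq_eq] at h1 h2 h4 h1' h2' h4' heq
    obtain ⟨heq, rfl⟩ := heq
    have hle : ∀ w ∈ insert u (insert v S), w ≤ v := by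
      intro w hw
      simp only [Finset.mem_insert] at hw
      rcases hw with rfl | rfl | hw
      · exact h1.le
      · exact le_rfl
      · rcases h4 w hw with h | h
        · exact (h.trans h1).le
        · exact h.1.le
    have hle' : ∀ w ∈ insert u (insert v' S'), w ≤ v' := by
      intro w hw
      simp only [Finset.mem_insert] at hw
      rcases hw with rfl | rfl | hw
      · exact h1'.le
      · exact le_rfl
      · rcases h4' w hw with h | h
        · exact (h.trans h1').le
        · exact h.1.le
    obtain rfl : v = v' := le_antisymm (hle' v (heq ▸ by simp)) (hle v' (heq ▸ by simp))
    have hv : v ∉ S := fun h => by rcases h4 v h with h | h <;> order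
    have hu : u ∉ S := fun h => by
      rcases h4 u h with h | h
      · order
      · exact h.2 rfl
    have hv' : v ∉ S' := fun h => by rcases h4' v h with h | h <;> order
    have hu' : u ∉ S' := fun h => by
      rcases h4' u h with h | h
      · order
      · exact h.2 rfl
    have := congrArg (fun Z => (Z.erase u).erase v) heq
    simp only [Finset.erase_insert_eq_erase] at this
    rw [Finset.erase_eq_of_notMem (a := u) (by simp [h1.ne, hu]),
      Finset.erase_eq_of_notMem (a := u) (by simp [h1.ne, hu']), Finset.erase_insert hv,
      Finset.erase_insert hv'] at this
    rw [this]
  · rintro ⟨U, u⟩ hx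
    obtain ⟨hU, hu⟩ := Finset.mem_sigma.1 hx
    have hUc := (Finset.mem_powersetCard.1 hU).2
    simp only [classMaxima, Finset.mem_filter] at hu hUc
    obtain ⟨hu, ⟨v, hv, hvc, hvm⟩, hum⟩ := hu
    have hlt : u < v := lt_of_le_of_ne (hvm u hu) fun e => hvc (congrArg c e.symm)
    refine ⟨⟨toLex (u, v), (U.erase u).erase v⟩, ?_, ?_⟩
    · simp only [Finset.mem_sigma, Finset.mem_powersetCard, mem_orderedEdges, ofLex_toLex]
      refine ⟨⟨hlt, hvc.symm⟩, fun w hw => mem_colonVars.2 ?_, ?_⟩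
      · simp only [Finset.mem_erase] at hw
        obtain ⟨hwv, hwu, hw⟩ := hw
        simp only [ofLex_toLex]
        by_cases hcw : c w = c u
        · exact Or.inl (lt_of_le_of_ne (hum w hw hcw) hwu)
        · exact Or.inr ⟨lt_of_le_of_ne (hvm w hw) hwv, hcw⟩
      · rw [Finset.card_erase_of_mem (Finset.mem_erase.2 ⟨hlt.ne', hv⟩),
          Finset.card_erase_of_mem hu, hUc]
        omega
    · simp only [ofLex_toLex]
      rw [Finset.insert_erase (Finset.mem_erase.2 ⟨hlt.ne', hv⟩), Finset.insert_erase hu]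

end Multipartite

/-- The edge ideal of a complete multipartite graph has a linear resolution. -/
theorem exists_linearResolution {V T : Type*} [Fintype V] [DecidableEq T] (k : Type*) [Field k]
    {Γ : SimpleGraph V} {c : V → T} (hΓ : ∀ u v, Γ.Adj u v ↔ c u ≠ c v) :
    ∃ G : CyclicResolution (graphIdeal k Γ),
      (∀ i, Fintype.card (G.ι (i + 1)) = multipartiteCount c (i + 2)) ∧ G.IsLinear 2 := by
  classical
  -- Any linear order will do: neither the ideal nor `multipartiteCount` depends on it.
  let _ : LinearOrder V := LinearOrder.lift' (Fintype.equivFin V) (Fintype.equivFin V).injective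
  obtain ⟨G, hGc, hGl⟩ := exists_resolution_of_isInitial k c (orderedEdges c) subset_rfl
    fun a _ e he _ => he
  rw [graphIdeal_eq_span_orderedEdges hΓ]
  exact ⟨G, fun i => (hGc i).trans (sum_choose_card_colonVars c i), hGl⟩

/-! ### Graded Betti numbers as counts of generators -/

section GradedBettiNumbers

variable {V : Type*} [Fintype V] {k : Type*} [Field k] {Γ : SimpleGraph V}

/-- Each multigraded Betti number counts the generators of one multidegree; the generators of total
degree `d` are fibred over their multidegrees. -/
theorem gradedBetti_eq_card (G : CyclicResolution (graphIdeal k Γ)) (hG : G.HasDistinctDegrees)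
    (i d : ℕ) : gradedBetti k Γ i d =
      (Finset.univ.filter fun b : G.ι i => (G.deg i b).degree = d).card := by
  classical
  rw [gradedBetti, Finset.card_eq_sum_card_fiberwise (f := G.deg i)
    (t := (Finset.univ : Finset V).finsuppAntidiag d)]
  · refine Finset.sum_congr (by congr!) fun a ha => ?_
    rw [multigradedBetti, MultigradedFreeResolution.finrank_gradedTor _ hG,
      Nat.card_eq_fintype_card, Fintype.card_subtype, Finset.filter_filter]
    congr 1
    ext b
    simp only [Finset.mem_filter, Finset.mem_univ, true_and]
    refine ⟨fun h => ⟨?_, h⟩, fun h => h.2⟩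
    rw [h, Finsupp.degree_eq_sum]
    exact (Finset.mem_finsuppAntidiag.1 ha).1
  · intro b hb
    simp only [Finset.coe_filter, Finset.mem_univ, true_and, Set.mem_ofPred_eq] at hb
    refine Finset.mem_coe.2 (Finset.mem_finsuppAntidiag.2 ⟨?_, Finset.subset_univ _⟩)
    rw [← hb, Finsupp.degree_eq_sum]

theorem multipartiteCount_one {T : Type*} [DecidableEq T] (c : V → T) :
    multipartiteCount c 1 = 0 := by
  refine Finset.sum_eq_zero fun U hU => ?_
  have := Finset.card_image_le (s := U) (f := c)
  rw [(Finset.mem_powersetCard.1 hU).2] at this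
  omega

variable {T : Type*} [DecidableEq T] {c : V → T}

theorem gradedBetti_zero_zero (k : Type*) [Field k] (hΓ : ∀ u v, Γ.Adj u v ↔ c u ≠ c v) :
    gradedBetti k Γ 0 0 = 1 := by
  obtain ⟨G, -, hGl⟩ := exists_linearResolution k hΓ
  rw [gradedBetti_eq_card G (hGl.hasDistinctDegrees two_pos), Finset.filter_true_of_mem]
  · exact G.card_zero
  · intro b _
    rw [G.deg_zero, map_zero]

theorem gradedBetti_succ (k : Type*) [Field k] (hΓ : ∀ u v, Γ.Adj u v ↔ c u ≠ c v) (i : ℕ) :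
    gradedBetti k Γ i (i + 1) = multipartiteCount c (i + 1) := by
  obtain ⟨G, hGc, hGl⟩ := exists_linearResolution k hΓ
  rw [gradedBetti_eq_card G (hGl.hasDistinctDegrees two_pos)]
  cases i with
  | zero =>
    -- For `i = 0` both sides vanish: one vertex meets one class, and the generator of step `0` has
    -- degree `0`.
    rw [multipartiteCount_one, Finset.card_eq_zero, Finset.filter_eq_empty_iff]
    intro b _
    rw [G.deg_zero, map_zero]
    exact zero_ne_one
  | succ i =>
    rw [Finset.filter_true_of_mem]
    · exact hGc i
    · intro b _
      exact hGl i b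

theorem gradedBetti_eq_zero (k : Type*) [Field k] (hΓ : ∀ u v, Γ.Adj u v ↔ c u ≠ c v) {i d : ℕ}
    (hd : d ≠ i + 1) (hi : (i, d) ≠ (0, 0)) : gradedBetti k Γ i d = 0 := by
  obtain ⟨G, -, hGl⟩ := exists_linearResolution k hΓ
  rw [gradedBetti_eq_card G (hGl.hasDistinctDegrees two_pos), Finset.card_eq_zero,
    Finset.filter_eq_empty_iff]
  intro b _ h
  cases i with
  | zero =>
    rw [G.deg_zero, map_zero] at h
    exact hi (by rw [← h])
  | succ i =>
    rw [hGl] at h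
    omega

end GradedBettiNumbers

/-! ### Closed formulas for `multipartiteCount` -/

section Counting

variable {V : Type*} [Fintype V] {T : Type*} [Fintype T] [DecidableEq T]

/-- The number of sets with prescribed numbers of elements in each class. -/
theorem card_filter_card_class_eq [DecidableEq V] (c : V → T) (α : T → ℕ) :
    (Finset.univ.filter fun U : Finset V => (fun j => (U.filter (c · = j)).card) = α).card =
      ∏ j, (Finset.univ.filter (c · = j)).card.choose (α j) := by
  simp only [← Finset.card_powersetCard]
  rw [← Fintype.card_piFinset]
  refine Finset.card_bij' (fun U _ j => U.filter (c · = j))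
    (fun P _ => Finset.univ.filter fun v => v ∈ P (c v)) ?_ ?_ ?_ ?_
  · intro U hU
    obtain rfl := (Finset.mem_filter.1 hU).2
    refine Fintype.mem_piFinset.2 fun j => Finset.mem_powersetCard.2
      ⟨Finset.filter_subset_filter _ (Finset.subset_univ _), rfl⟩
  · intro P hP
    refine Finset.mem_filter.2 ⟨Finset.mem_univ _, funext fun j => ?_⟩
    obtain ⟨h1, h2⟩ := Finset.mem_powersetCard.1 (Fintype.mem_piFinset.1 hP j)
    rw [← h2]
    congr 1
    ext v
    simp only [Finset.mem_filter, Finset.mem_univ, true_and]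
    constructor
    · rintro ⟨h, rfl⟩
      exact h
    · intro h
      obtain rfl := (Finset.mem_filter.1 (h1 h)).2
      exact ⟨h, rfl⟩
  · intro U _
    ext v
    simp
  · intro P hP
    funext j
    ext v
    simp only [Finset.mem_filter, Finset.mem_univ, true_and]
    obtain ⟨h1, h2⟩ := Finset.mem_powersetCard.1 (Fintype.mem_piFinset.1 hP j)
    constructor
    · rintro ⟨h, rfl⟩
      exact h
    · intro h
      obtain rfl := (Finset.mem_filter.1 (h1 h)).2
      exact ⟨h, rfl⟩

/-- Sort the sets `U` by the numbers `α j` of their vertices in each class. The classes met form `s`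
iff `α` has support `s`, and a class outside `s` contributes the factor `choose _ 0 = 1`. -/
theorem card_filter_image_eq (c : V → T) (N : ℕ) (s : Finset T) :
    (((Finset.univ : Finset V).powersetCard N).filter fun U => U.image c = s).card =
      ∑ α ∈ s.piAntidiag N with ∀ j ∈ s, 1 ≤ α j,
        ∏ j ∈ s, (Finset.univ.filter (c · = j)).card.choose (α j) := by
  classical
  have hsum : ∀ U : Finset V, ∑ j ∈ U.image c, (U.filter (c · = j)).card = U.card := fun U =>
    (Finset.card_eq_sum_card_fiberwise fun v hv => Finset.mem_image_of_mem c hv).symm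
  have hne : ∀ (U : Finset V) j, (U.filter (c · = j)).card ≠ 0 ↔ j ∈ U.image c := fun U j => by
    rw [Finset.card_ne_zero, Finset.mem_image]
    exact ⟨fun ⟨v, hv⟩ => ⟨v, (Finset.mem_filter.1 hv).1, (Finset.mem_filter.1 hv).2⟩,
      fun ⟨v, hv, h⟩ => ⟨v, Finset.mem_filter.2 ⟨hv, h⟩⟩⟩
  rw [Finset.card_eq_sum_card_fiberwise (f := fun U j => (U.filter (c · = j)).card)
    (t := (s.piAntidiag N).filter fun α => ∀ j ∈ s, 1 ≤ α j)]
  · refine Finset.sum_congr rfl fun α hα => ?_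
    obtain ⟨h1, h2⟩ := Finset.mem_filter.1 hα
    obtain ⟨h3, h4⟩ := Finset.mem_piAntidiag.1 h1
    rw [Finset.prod_subset (Finset.subset_univ s), ← card_filter_card_class_eq]
    · congr 1
      ext U
      simp only [Finset.mem_filter, Finset.mem_powersetCard, Finset.subset_univ, true_and,
        Finset.mem_univ, and_iff_right_iff_imp]
      rintro rfl
      have hs : U.image c = s := by
        ext j
        rw [← hne]
        exact ⟨h4 j, fun h => Nat.one_le_iff_ne_zero.1 (h2 j h)⟩
      refine ⟨?_, hs⟩
      rw [← hsum, hs]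
      exact h3
    · intro j _ hj
      have : α j = 0 := by
        by_contra h
        exact hj (h4 j h)
      rw [this, Nat.choose_zero_right]
  · intro U hU
    obtain ⟨h1, rfl⟩ := Finset.mem_filter.1 (Finset.mem_coe.1 hU)
    refine Finset.mem_coe.2 (Finset.mem_filter.2 ⟨Finset.mem_piAntidiag.2 ⟨?_, fun j => ?_⟩,
      fun j hj => ?_⟩)
    · rw [hsum]
      exact (Finset.mem_powersetCard.1 h1).2
    · exact (hne U j).1
    · exact Nat.one_le_iff_ne_zero.2 ((hne U j).2 hj)

/-- The summand depends only on the set `s` of classes met. The truncated `s.card - 1` vanishes for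
at most one class, so `l` may start at `2`. -/
theorem multipartiteCount_eq_sum (c : V → T) (N : ℕ) :
    multipartiteCount c N = ∑ l ∈ Finset.Icc 2 (Fintype.card T), (l - 1) *
      ∑ s ∈ (Finset.univ : Finset T).powersetCard l,
        ∑ α ∈ s.piAntidiag N with ∀ j ∈ s, 1 ≤ α j,
          ∏ j ∈ s, (Finset.univ.filter (c · = j)).card.choose (α j) := by
  classical
  simp only [← card_filter_image_eq]
  set A : Finset T → ℕ := fun s =>
    (((Finset.univ : Finset V).powersetCard N).filter fun U => U.image c = s).card with hA
  have h1 : multipartiteCount c N = ∑ s : Finset T, (s.card - 1) * A s := by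
    rw [multipartiteCount, ← Finset.sum_fiberwise _ (fun U => U.image c)]
    refine Finset.sum_congr rfl fun s _ => ?_
    rw [Finset.sum_congr rfl fun U hU => by rw [(Finset.mem_filter.1 hU).2], Finset.sum_const,
      smul_eq_mul, mul_comm]
  have h2 : ∀ l ∈ Finset.Icc 2 (Fintype.card T),
      (l - 1) * ∑ s ∈ (Finset.univ : Finset T).powersetCard l, A s =
      ∑ s ∈ (Finset.univ.filter fun s : Finset T => 2 ≤ s.card) with s.card = l,
        (s.card - 1) * A s := fun l hl => by
    rw [Finset.mul_sum]
    refine Finset.sum_congr ?_ fun s hs => by rw [(Finset.mem_filter.1 hs).2]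
    ext s
    simp only [Finset.mem_powersetCard, Finset.subset_univ, true_and, Finset.mem_filter,
      Finset.mem_univ]
    exact ⟨fun h => ⟨h ▸ (Finset.mem_Icc.1 hl).1, h⟩, fun h => h.2⟩
  rw [Finset.sum_congr rfl h2, Finset.sum_fiberwise_of_maps_to, h1]
  · refine (Finset.sum_filter_of_ne fun s _ hs => ?_).symm
    have := left_ne_zero_of_mul hs
    omega
  · intro s hs
    exact Finset.mem_Icc.2 ⟨(Finset.mem_filter.1 hs).2, Finset.card_le_univ s⟩

theorem multipartiteCount_fin_two (c : V → Fin 2) (N : ℕ) :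
    multipartiteCount c N = ∑ p ∈ Finset.HasAntidiagonal.antidiagonal N with 1 ≤ p.1 ∧ 1 ≤ p.2,
      (Finset.univ.filter (c · = 0)).card.choose p.1 *
        (Finset.univ.filter (c · = 1)).card.choose p.2 := by
  have h : (Finset.univ : Finset (Fin 2)).powersetCard 2 = {Finset.univ} :=
    Finset.powersetCard_self _
  rw [multipartiteCount_eq_sum, Fintype.card_fin, Finset.Icc_self, Finset.sum_singleton, h,
    Finset.sum_singleton, Nat.add_one_sub_one, one_mul]
  refine Finset.sum_bij' (fun α _ => (α 0, α 1)) (fun p _ => ![p.1, p.2]) ?_ ?_ ?_ ?_ ?_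
  · intro α hα
    simpa [Fin.sum_univ_two, Fin.forall_fin_two] using hα
  · intro p hp
    simpa [Fin.sum_univ_two, Fin.forall_fin_two] using hp
  · intro α _
    ext j
    fin_cases j <;> rfl
  · intro p _
    rfl
  · intro α _
    rw [Fin.prod_univ_two]

end Counting

theorem multipartiteCount_completeBipartite (n m N : ℕ) :
    multipartiteCount (Sum.elim (fun _ => 0) (fun _ => 1) : Fin n ⊕ Fin m → Fin 2) N =
      ∑ p ∈ Finset.HasAntidiagonal.antidiagonal N with 1 ≤ p.1 ∧ 1 ≤ p.2,
        n.choose p.1 * m.choose p.2 := by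
  rw [multipartiteCount_fin_two]
  simp [Finset.card_filter, -Finset.sum_boole]

theorem multipartiteCount_sigma_fst {t : ℕ} (n : Fin t → ℕ) (N : ℕ) :
    multipartiteCount (Sigma.fst : (Σ j : Fin t, Fin (n j)) → Fin t) N =
      ∑ l ∈ Finset.Icc 2 t, (l - 1) * ∑ s ∈ (Finset.univ : Finset (Fin t)).powersetCard l,
        ∑ α ∈ s.piAntidiag N with ∀ j ∈ s, 1 ≤ α j, ∏ j ∈ s, (n j).choose (α j) := by
  have h : ∀ j, (Finset.univ.filter fun v : Σ j : Fin t, Fin (n j) => v.1 = j).card = n j := by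
    intro j
    rw [Finset.card_filter, Fintype.sum_sigma, Finset.sum_eq_single j]
    · simp
    · intro b _ hb
      simp [hb]
    · exact fun h => absurd (Finset.mem_univ j) h
  rw [multipartiteCount_eq_sum, Fintype.card_fin]
  simp only [h]
  congr!

/-- The class of the centre has one vertex, so only the term taking exactly one vertex from it
survives. -/
theorem multipartiteCount_star (n i : ℕ) :
    multipartiteCount (fun v : Fin (n + 1) => if v = 0 then (0 : Fin 2) else 1) (i + 2) =
      n.choose (i + 1) := by
  have h0 : (Finset.univ.filter fun v : Fin (n + 1) =>
      (if v = 0 then (0 : Fin 2) else 1) = 0).card = 1 := by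
    rw [Finset.card_eq_one]
    exact ⟨0, by ext v; by_cases h : v = 0 <;> simp [h]⟩
  have h1 : (Finset.univ.filter fun v : Fin (n + 1) =>
      (if v = 0 then (0 : Fin 2) else 1) = 1).card = n := by
    simp [Finset.card_filter, Fin.sum_univ_succ, -Finset.sum_boole]
  rw [multipartiteCount_fin_two, h0, h1, Finset.sum_eq_single (1, i + 1)]
  · simp
  · rintro ⟨p, q⟩ hp hne
    simp only [Finset.mem_filter, Finset.HasAntidiagonal.mem_antidiagonal] at hp
    have : 1 < p := by
      by_contra hlt
      obtain rfl : p = 1 := by omega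
      exact hne (by rw [show q = i + 1 by omega])
    rw [Nat.choose_eq_zero_of_lt this, zero_mul]
  · intro h
    exact absurd (Finset.mem_filter.2 ⟨Finset.HasAntidiagonal.mem_antidiagonal.2 (by omega), by simp⟩) h

/-! ### Categorical Tor and projective dimension -/

namespace CyclicResolution

variable {V k : Type*} [Field k] {I : Ideal (MvPolynomial V k)}

/-- The free module `F_i` as an object of the category of modules. -/
abbrev obj (G : CyclicResolution I) (i : ℕ) : ModuleCat (MvPolynomial V k) :=
  ModuleCat.of (MvPolynomial V k) (G.ι i → MvPolynomial V k)

/-- A resolution as a chain complex. -/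
def chainComplex (G : CyclicResolution I) : ChainComplex (ModuleCat (MvPolynomial V k)) ℕ :=
  ChainComplex.of G.obj (fun i => ModuleCat.ofHom (G.d i)) fun i => by
    rw [← ModuleCat.ofHom_comp, G.d_comp_d]
    rfl

/-- The augmentation `F₀ → R/I`. -/
def augmentation (G : CyclicResolution I) :
    (G.ι 0 → MvPolynomial V k) →ₗ[MvPolynomial V k] (MvPolynomial V k ⧸ I) :=
  Submodule.mkQ I ∘ₗ LinearMap.proj default

theorem augmentation_surjective (G : CyclicResolution I) : Function.Surjective G.augmentation :=
  (Submodule.mkQ_surjective I).comp fun p => ⟨fun _ => p, rfl⟩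

theorem exact_augmentation (G : CyclicResolution I) : Function.Exact (G.d 0) G.augmentation :=
  fun x => (Submodule.Quotient.mk_eq_zero I).trans (G.mem_range_zero x).symm

theorem chainComplex_d (G : CyclicResolution I) (i : ℕ) :
    G.chainComplex.d (i + 1) i = ModuleCat.ofHom (G.d i) := by
  unfold chainComplex
  exact ChainComplex.of_d G.obj (fun i => ModuleCat.ofHom (G.d i)) i

theorem d_comp_augmentation (G : CyclicResolution I) :
    G.chainComplex.d 1 0 ≫ ModuleCat.ofHom G.augmentation = 0 := by
  rw [chainComplex_d]
  ext x
  exact G.exact_augmentation.apply_apply_eq_zero _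

/-- A multigraded resolution is a projective resolution. -/
def projectiveResolution (G : CyclicResolution I) :
    ProjectiveResolution (ModuleCat.of (MvPolynomial V k) (MvPolynomial V k ⧸ I)) where
  complex := G.chainComplex
  projective i := ModuleCat.projective_of_free (Pi.basisFun (MvPolynomial V k) (G.ι i))
  π := (ChainComplex.toSingle₀Equiv _ _).symm ⟨ModuleCat.ofHom G.augmentation, G.d_comp_augmentation⟩
  quasiIso := ⟨fun n => by
    cases n with
    | zero =>
      -- In degree `0` the claim is that `F₁ → F₀ → R/I → 0` is exact.
      rw [ChainComplex.quasiIsoAt₀_iff, ShortComplex.quasiIso_iff_of_zeros']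
      · refine (ShortComplex.exact_and_epi_g_iff_of_iso ?_).2
          (?_ : (ModuleCat.shortComplexOfCompEqZero (G.d 0) G.augmentation
            G.exact_augmentation.linearMap_comp_eq_zero).Exact ∧ Epi _)
        · exact ShortComplex.isoMk (Iso.refl _) (Iso.refl _) (Iso.refl _)
            ((Category.id_comp _).trans ((G.chainComplex_d 0).symm.trans (Category.comp_id _).symm))
            ((Category.id_comp _).trans ((ChainComplex.toSingle₀Equiv_symm_apply_f_zero
              (C := G.chainComplex) (ModuleCat.ofHom G.augmentation)
              G.d_comp_augmentation).symm.trans (Category.comp_id _).symm))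
        · exact ⟨ModuleCat.shortComplex_exact _ G.exact_augmentation,
            (ModuleCat.epi_iff_surjective _).2 G.augmentation_surjective⟩
      all_goals rfl
    | succ n =>
      rw [quasiIsoAt_iff_exactAt']
      · rw [HomologicalComplex.exactAt_iff' _ (n + 1 + 1) (n + 1) n (by simp) (by simp)]
        rw [ShortComplex.ShortExact.moduleCat_exact_iff_function_exact]
        simp only [HomologicalComplex.sc', HomologicalComplex.shortComplexFunctor', chainComplex_d]
        exact G.exact_succ n
      · apply ChainComplex.exactAt_succ_single_obj⟩


theorem constantCoeff_eq_zero_iff {p : MvPolynomial V k} :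
    constantCoeff p = 0 ↔ p ∈ Ideal.span (Set.range (X : V → MvPolynomial V k)) := by
  rw [← Set.image_univ, mem_ideal_span_X_image]
  constructor
  · intro h m hm
    by_contra! h'
    obtain rfl : m = 0 := Finsupp.ext fun v => h' v trivial
    exact mem_support_iff.1 hm h
  · intro h
    by_contra h'
    obtain ⟨v, -, hv⟩ := h 0 (mem_support_iff.2 h')
    exact hv rfl

theorem HasDistinctDegrees.constantCoeff_d {G : CyclicResolution I} (hG : G.HasDistinctDegrees)
    (i : ℕ) (x : G.ι (i + 1) → MvPolynomial V k) (c : G.ι i) : constantCoeff (G.d i x c) = 0 := by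
  rw [← Finset.univ_sum_single x, map_sum, Finset.sum_apply, map_sum]
  refine Finset.sum_eq_zero fun b _ => ?_
  have : (Pi.single b (x b) : G.ι (i + 1) → MvPolynomial V k) = x b • Pi.single b 1 := by
    rw [← Pi.single_smul, smul_eq_mul, mul_one]
  rw [this, map_smul, Pi.smul_apply, smul_eq_mul, map_mul,
    (G.homog i).constantCoeff_eq_zero (hG i b c), mul_zero]

/-- The coordinates of `G.d i x` have no constant term, so moved across the tensor sign they
annihilate the residue field. -/
theorem HasDistinctDegrees.lTensor_d {G : CyclicResolution I} (hG : G.HasDistinctDegrees) (i : ℕ) :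
    (G.d i).lTensor (MvPolynomial V k ⧸ Ideal.span (Set.range (X : V → MvPolynomial V k))) = 0 := by
  refine TensorProduct.ext' fun y x => ?_
  rw [LinearMap.lTensor_tmul, LinearMap.zero_apply, ← Finset.univ_sum_single (G.d i x),
    TensorProduct.tmul_sum]
  refine Finset.sum_eq_zero fun c _ => ?_
  have h : (Pi.single c (G.d i x c) : G.ι i → MvPolynomial V k) =
      G.d i x c • Pi.single c 1 := by
    rw [← Pi.single_smul, smul_eq_mul, mul_one]
  obtain ⟨p, rfl⟩ := Ideal.Quotient.mk_surjective y
  have h0 : G.d i x c • Ideal.Quotient.mk (Ideal.span (Set.range (X : V → MvPolynomial V k))) p =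
      0 := by
    change Ideal.Quotient.mk _ (G.d i x c * p) = 0
    rw [Ideal.Quotient.eq_zero_iff_mem]
    exact Ideal.mul_mem_right _ _ (constantCoeff_eq_zero_iff.1 (hG.constantCoeff_d i x c))
  rw [h, ← TensorProduct.smul_tmul, h0, TensorProduct.zero_tmul]

/-- `Tor_i(k, R/I) ≅ k ⊗ F_i` for a minimal resolution `F`. -/
def HasDistinctDegrees.torIso {G : CyclicResolution I} (hG : G.HasDistinctDegrees) (i : ℕ) :
    ((Tor (ModuleCat (MvPolynomial V k)) i).obj (residueModule V k)).obj
      (ModuleCat.of _ (MvPolynomial V k ⧸ I)) ≅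
    ModuleCat.of (MvPolynomial V k) (G.ι i →
      MvPolynomial V k ⧸ Ideal.span (Set.range (X : V → MvPolynomial V k))) := by
  let F := (MonoidalCategory.tensoringLeft _).obj (residueModule V k)
  let D := (F.mapHomologicalComplex _).obj G.chainComplex
  have hD : ∀ a b, D.d a b = 0 := by
    intro a b
    by_cases h : (ComplexShape.down ℕ).Rel a b
    · obtain rfl : b + 1 = a := h
      change F.map (G.chainComplex.d (b + 1) b) = 0
      rw [chainComplex_d]
      exact ModuleCat.hom_ext (hG.lTensor_d b)
    · exact D.shape _ _ h
  exact G.projectiveResolution.isoLeftDerivedObj F i ≪≫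
    (ShortComplex.LeftHomologyData.ofZeros (D.sc i) (hD _ _) (hD _ _)).homologyIso ≪≫
    (TensorProduct.piScalarRight (MvPolynomial V k) (MvPolynomial V k) _ (G.ι i)).toModuleIso

/-- The constant coefficient identifies `R/⟨x_v⟩` with `k`, compatibly with the scalar action
through `C`. -/
theorem rank_restrictScalars_residue (ι : Type) [Fintype ι] :
    Module.rank k ((ModuleCat.restrictScalars (MvPolynomial.C (σ := V) (R := k))).obj
      (ModuleCat.of (MvPolynomial V k) (ι →
        MvPolynomial V k ⧸ Ideal.span (Set.range (X : V → MvPolynomial V k))))) =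
      Fintype.card ι := by
  let ε : (MvPolynomial V k ⧸ Ideal.span (Set.range (X : V → MvPolynomial V k))) →+* k :=
    Ideal.Quotient.lift _ constantCoeff fun p hp => constantCoeff_eq_zero_iff.2 hp
  let f : ((ModuleCat.restrictScalars (MvPolynomial.C (σ := V) (R := k))).obj
      (ModuleCat.of (MvPolynomial V k) (ι →
        MvPolynomial V k ⧸ Ideal.span (Set.range (X : V → MvPolynomial V k))))) →ₗ[k] (ι → k) :=
    { toFun := fun x j => ε (x j)
      map_add' := fun x y => funext fun j => map_add ε (x j) (y j)
      map_smul' := fun a x => funext fun j => by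
        obtain ⟨p, hp⟩ := Ideal.Quotient.mk_surjective (x j)
        change ε ((C a : MvPolynomial V k) • x j) = a * ε (x j)
        rw [← hp]
        change constantCoeff (C a * p) = a * constantCoeff p
        rw [map_mul, constantCoeff_C] }
  have hf : Function.Bijective f := by
    constructor
    · rw [injective_iff_map_eq_zero]
      intro x hx
      funext j
      obtain ⟨p, hp⟩ := Ideal.Quotient.mk_surjective (x j)
      have h1 : ε (x j) = 0 := congrFun hx j
      rw [← hp] at h1
      rw [← hp]
      exact Ideal.Quotient.eq_zero_iff_mem.2 (constantCoeff_eq_zero_iff.1 h1)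
    · intro y
      exact ⟨fun j => Ideal.Quotient.mk _ (C (y j)), funext fun j => constantCoeff_C _ _⟩
  exact rank_eq_card_basis (Module.Basis.ofEquivFun (LinearEquiv.ofBijective f hf))

/-! ### Projective dimension -/

theorem exact_rangeRestrict (G : CyclicResolution I) (j : ℕ) :
    Function.Exact (G.d (j + 1)) (G.d j).rangeRestrict := by
  rw [LinearMap.exact_iff, LinearMap.ker_rangeRestrict]
  exact (G.exact_succ j).linearMap_ker_eq

/-- Dimension shifting: the range of `G.d j` is the syzygy of order `j + 1` of `R/I`. The bound on
the right stays at least `1`, since a projective quotient does not force the kernel to be zero. -/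
theorem hasProjectiveDimensionLT_quotient_iff (G : CyclicResolution I) (j m : ℕ) :
    HasProjectiveDimensionLT (ModuleCat.of (MvPolynomial V k) (MvPolynomial V k ⧸ I)) (j + m + 2) ↔
      HasProjectiveDimensionLT (ModuleCat.of (MvPolynomial V k) (LinearMap.range (G.d j)))
        (m + 1) := by
  have hproj : ∀ i, Projective (G.obj i) := fun i =>
    ModuleCat.projective_of_free (Pi.basisFun (MvPolynomial V k) (G.ι i))
  induction j generalizing m with
  | zero =>
    rw [zero_add, ← G.exact_augmentation.linearMap_ker_eq]
    exact (LinearMap.shortExact_shortComplexKer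
      G.augmentation_surjective).hasProjectiveDimensionLT_X₃_iff m (hproj 0)
  | succ j ih =>
    rw [show j + 1 + m + 2 = j + (m + 1) + 2 by omega]
    refine (ih (m + 1)).trans ?_
    rw [← (G.exact_succ j).linearMap_ker_eq, ← LinearMap.ker_rangeRestrict]
    exact (LinearMap.shortExact_shortComplexKer
      (G.d j).surjective_rangeRestrict).hasProjectiveDimensionLT_X₃_iff m (hproj (j + 1))

/-- In a minimal resolution, the cokernel of a nonzero differential is not projective. -/
theorem HasDistinctDegrees.not_projective {G : CyclicResolution I} (hG : G.HasDistinctDegrees)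
    {j : ℕ} (b : G.ι (j + 1)) {M : Type*} [AddCommGroup M] [Module (MvPolynomial V k) M]
    (p : (G.ι j → MvPolynomial V k) →ₗ[MvPolynomial V k] M) (hp : Function.Surjective p)
    (hex : Function.Exact (G.d j) p) : ¬ Module.Projective (MvPolynomial V k) M := by
  intro hM
  obtain ⟨s, hs⟩ := Module.projective_lifting_property p LinearMap.id hp
  have hs' : ∀ y, p (s y) = y := LinearMap.congr_fun hs
  -- A section `s` of `p` makes `id - s p` factor through `G.d j` as `d r`. Then `r d e_b - e_b` is
  -- a cycle, hence a boundary.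
  have hr : ∀ x, ∃ y, G.d j y = x - s (p x) := fun x => (hex _).1 (by rw [map_sub, hs', sub_self])
  choose y hy using fun c : G.ι j => hr (Pi.single c 1)
  let r := Fintype.linearCombination (MvPolynomial V k) y
  have hrd : ∀ x, G.d j (r x) = x - s (p x) := by
    have : G.d j ∘ₗ r = LinearMap.id - s ∘ₗ p := by
      refine LinearMap.pi_ext' fun c => LinearMap.ext_ring ?_
      change G.d j (r (Pi.single c 1)) = Pi.single c 1 - s (p (Pi.single c 1))
      rw [Fintype.linearCombination_apply_single, one_smul, hy]
    exact LinearMap.congr_fun this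
  have h1 : G.d j (r (G.d j (Pi.single b 1)) - Pi.single b 1) = 0 := by
    rw [map_sub, hrd, hex.apply_apply_eq_zero, map_zero, sub_zero, sub_self]
  obtain ⟨z, hz⟩ := G.mem_range h1
  -- By minimality neither this boundary nor `r d e_b` has a constant term in coordinate `b`,
  -- whereas `e_b` has `1` there.
  have h2 := hG.constantCoeff_d (j + 1) z b
  rw [hz, Pi.sub_apply, map_sub, constantCoeff_comp_basis, Pi.single_eq_same, map_one,
    Finset.sum_eq_zero fun e _ => by rw [hG.constantCoeff_d, mul_zero]] at h2
  simp at h2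

/-- If step `n + 1` vanishes, the cokernel of `G.d n` is the free module of step `n`, which bounds
the dimension above. Below, a generator in step `n` makes the preceding cokernel non-projective; for
`n = 0` it only has to be seen that `R/I` is nonzero. -/
theorem HasDistinctDegrees.projectiveDimension_eq {G : CyclicResolution I}
    (hG : G.HasDistinctDegrees) (n : ℕ) (hn : Nonempty (G.ι n)) (hn' : IsEmpty (G.ι (n + 1))) :
    projectiveDimension (ModuleCat.of (MvPolynomial V k) (MvPolynomial V k ⧸ I)) = n := by
  refine le_antisymm ?_ ?_
  · have hinj : ∀ {M : Type _} [AddCommGroup M] [Module (MvPolynomial V k) M]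
        (p : (G.ι n → MvPolynomial V k) →ₗ[MvPolynomial V k] M), Function.Surjective p →
        Function.Exact (G.d n) p → Module.Projective (MvPolynomial V k) M := by
      intro M _ _ p hp hex
      refine Module.Projective.of_equiv (LinearEquiv.ofBijective p
        ⟨(injective_iff_map_eq_zero p).2 fun x hx => ?_, hp⟩)
      obtain ⟨y, rfl⟩ := (hex x).1 hx
      rw [Subsingleton.elim y 0, map_zero]
    rw [projectiveDimension_le_iff]
    cases n with
    | zero =>
      rw [← projective_iff_hasProjectiveDimensionLE_zero, ← IsProjective.iff_projective]
      exact hinj _ G.augmentation_surjective G.exact_augmentation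
    | succ j =>
      refine (G.hasProjectiveDimensionLT_quotient_iff j 0).2 ?_
      rw [← projective_iff_hasProjectiveDimensionLT_one, ← IsProjective.iff_projective]
      exact hinj _ (G.d j).surjective_rangeRestrict (G.exact_rangeRestrict j)
  · rw [projectiveDimension_ge_iff]
    intro h
    obtain ⟨b⟩ := hn
    match n, b, h with
    | 0, b, h =>
      rw [hasProjectiveDimensionLT_zero_iff_isZero, ModuleCat.isZero_iff_subsingleton] at h
      -- If `R/I` were zero, `1` would be a boundary, but boundaries have no constant term.
      have h1 := (G.exact_augmentation (Pi.single default 1)).1 (Subsingleton.elim (h := h) _ _)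
      obtain ⟨z, hz⟩ := h1
      have h2 := hG.constantCoeff_d 0 z default
      rw [hz, Pi.single_eq_same, map_one] at h2
      exact one_ne_zero h2
    | 1, b, h =>
      rw [← projective_iff_hasProjectiveDimensionLT_one, ← IsProjective.iff_projective] at h
      exact hG.not_projective b _ G.augmentation_surjective G.exact_augmentation h
    | j + 2, b, h =>
      rw [G.hasProjectiveDimensionLT_quotient_iff j 0,
        ← projective_iff_hasProjectiveDimensionLT_one, ← IsProjective.iff_projective] at h
      refine hG.not_projective b _ (G.d j).surjective_rangeRestrict
        (G.exact_rangeRestrict j) h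

end CyclicResolution

/-! ### Stars, and the three families as colourings -/

theorem betti_eq_card {V : Type*} [Fintype V] {k : Type*} [Field k] {Γ : SimpleGraph V}
    {G : CyclicResolution (graphIdeal k Γ)} (hG : G.HasDistinctDegrees) (i : ℕ) :
    betti k Γ i = Fintype.card (G.ι i) := by
  rw [← CyclicResolution.rank_restrictScalars_residue (V := V) (k := k) (G.ι i)]
  exact ((ModuleCat.restrictScalars (MvPolynomial.C (σ := V) (R := k))).mapIso
    (hG.torIso i)).toLinearEquiv.rank_eq

theorem exists_starResolution (k : Type*) [Field k] (n : ℕ) :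
    ∃ G : CyclicResolution (graphIdeal k (SimpleGraph.starGraph (0 : Fin (n + 1)))),
      (∀ i, Fintype.card (G.ι i) = n.choose i) ∧ G.HasDistinctDegrees := by
  obtain ⟨G, hGc, hGl⟩ := exists_linearResolution k
    (Γ := SimpleGraph.starGraph (0 : Fin (n + 1)))
    (c := fun v => if v = 0 then (0 : Fin 2) else 1) (fun u v => by
      rw [SimpleGraph.starGraph_adj]
      by_cases hu : u = 0 <;> by_cases hv : v = 0 <;> simp [hu, hv, Ne.symm])
  refine ⟨G, fun i => ?_, hGl.hasDistinctDegrees two_pos⟩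
  cases i with
  | zero => rw [G.card_zero, Nat.choose_zero_right]
  | succ i => rw [hGc, multipartiteCount_star]

theorem betti_star (k : Type*) [Field k] (n i : ℕ) :
    betti k (SimpleGraph.starGraph (0 : Fin (n + 1))) i = (n.choose i : Cardinal) := by
  obtain ⟨G, hGc, hG⟩ := exists_starResolution k n
  rw [betti_eq_card hG, hGc]

theorem projDim_star (k : Type*) [Field k] (n : ℕ) :
    projDim k (SimpleGraph.starGraph (0 : Fin (n + 1))) = (n : WithBot ℕ∞) := by
  obtain ⟨G, hGc, hG⟩ := exists_starResolution k n
  refine hG.projectiveDimension_eq n (Fintype.card_pos_iff.1 ?_) (Fintype.card_eq_zero_iff.1 ?_)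
  · rw [hGc, Nat.choose_self]
    exact one_pos
  · rw [hGc, Nat.choose_succ_self]

theorem completeBipartiteGraph_adj_iff (n m : ℕ) (u v : Fin n ⊕ Fin m) :
    (completeBipartiteGraph (Fin n) (Fin m)).Adj u v ↔
      (Sum.elim (fun _ => 0) (fun _ => 1) u : Fin 2) ≠ Sum.elim (fun _ => 0) (fun _ => 1) v := by
  rcases u with u | u <;> rcases v with v | v <;> simp

theorem completeMultipartiteGraph_adj_iff {t : ℕ} (n : Fin t → ℕ) (u v : Σ j, Fin (n j)) :
    (SimpleGraph.completeMultipartiteGraph fun j : Fin t => Fin (n j)).Adj u v ↔ u.1 ≠ v.1 :=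
  Iff.rfl

end GraphBetti

end

theorem mainTheorem12 (k : Type*) [Field k] :
    -- complete bipartite graphs
    (∀ n m : ℕ,
      GraphBetti.gradedBetti k (completeBipartiteGraph (Fin n) (Fin m)) 0 0 = 1 ∧
      (∀ i : ℕ, GraphBetti.gradedBetti k (completeBipartiteGraph (Fin n) (Fin m)) i (i + 1) =
        ∑ p ∈ Finset.HasAntidiagonal.antidiagonal (i + 1) with 1 ≤ p.1 ∧ 1 ≤ p.2,
          n.choose p.1 * m.choose p.2) ∧
      (∀ i d : ℕ, d ≠ i + 1 → (i, d) ≠ (0, 0) →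
        GraphBetti.gradedBetti k (completeBipartiteGraph (Fin n) (Fin m)) i d = 0)) ∧
    -- complete multipartite graphs
    (∀ (t : ℕ) (n : Fin t → ℕ),
      GraphBetti.gradedBetti k
        (SimpleGraph.completeMultipartiteGraph (fun j : Fin t => Fin (n j))) 0 0 = 1 ∧
      (∀ i : ℕ, GraphBetti.gradedBetti k
        (SimpleGraph.completeMultipartiteGraph (fun j : Fin t => Fin (n j))) i (i + 1) =
        ∑ l ∈ Finset.Icc 2 t, (l - 1) *
          ∑ s ∈ (Finset.univ : Finset (Fin t)).powersetCard l,
            ∑ α ∈ s.piAntidiag (i + 1) with ∀ j ∈ s, 1 ≤ α j,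
              ∏ j ∈ s, (n j).choose (α j)) ∧
      (∀ i d : ℕ, d ≠ i + 1 → (i, d) ≠ (0, 0) →
        GraphBetti.gradedBetti k
          (SimpleGraph.completeMultipartiteGraph (fun j : Fin t => Fin (n j))) i d = 0)) ∧
    -- star graphs
    (∀ n : ℕ,
      (∀ i : ℕ, GraphBetti.betti k (SimpleGraph.starGraph (0 : Fin (n + 1))) i =
        (n.choose i : Cardinal)) ∧
      GraphBetti.projDim k (SimpleGraph.starGraph (0 : Fin (n + 1))) = (n : WithBot ℕ∞)) := by
  refine ⟨fun n m => ?_, fun t n => ?_, fun n =>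
    ⟨GraphBetti.betti_star k n, GraphBetti.projDim_star k n⟩⟩
  · have h := GraphBetti.completeBipartiteGraph_adj_iff n m
    exact ⟨GraphBetti.gradedBetti_zero_zero k h, fun i => (GraphBetti.gradedBetti_succ k h i).trans
      (GraphBetti.multipartiteCount_completeBipartite n m (i + 1)), fun i d hd hi =>
      GraphBetti.gradedBetti_eq_zero k h hd hi⟩
  · have h := GraphBetti.completeMultipartiteGraph_adj_iff n
    exact ⟨GraphBetti.gradedBetti_zero_zero k h, fun i => (GraphBetti.gradedBetti_succ k h i).trans
      (GraphBetti.multipartiteCount_sigma_fst n (i + 1)), fun i d hd hi =>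
      GraphBetti.gradedBetti_eq_zero k h hd hi⟩
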